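/- For integers $a_1,a_2$, let $g_{a_1,a_2}(z)\in\mathbb{Z}((z^{-1}))$ denote any Laurent series in $z^{-1}$ with integer coefficients that solves the functional equation $$g_{a_1,a_2}(z)=(z^2+a_1z+a_2)\,g_{a_1,a_2}(z^3).$$ For a real number $\xi$, let $\mu(\xi)$ be its irrationality exponent, i.e. the supremum of the real numbers $\mu$ such that $\left|\xi-\frac pq\right|<q^{-\mu}$ has infinitely many rational solutions $\frac pq$. Theorem 3. Let $b$ be an integer with $|b|\ge 2$. Then all the series $g_{a_1,a_2}$ converge at $z=b$, and: (a) for every $s\in\mathbb{Z}$, if $g_{s,s^2}(b)$ is irrational, then $\mu(g_{s,s^2}(b))=3$; (b) for every $s\in\mathbb{Z}$, if $g_{s^3,-s^2(s^2+1)}(b)$ is irrational, then $\mu(g_{s^3,-s^2(s^2+1)}(b))=3$; (c) for each choice of the sign, if $g_{\pm2,1}(b)$ is irrational, then $\mu(g_{\pm2,1}(b))=\frac{12}{5}$. -/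

import Mathlib

noncomputable section

/-- The irrationality exponent of a real number `ξ`: the supremum (in the extended reals) of the
real numbers `m` such that `|ξ - p / q| < q ^ (-m)` has infinitely many rational solutions `p / q`,
a rational number being written in lowest terms with positive denominator. -/
def irrationalityExponent (ξ : ℝ) : EReal :=
  sSup ((fun m : ℝ => (m : EReal)) ''
    {m : ℝ | {r : ℚ | |ξ - (r : ℝ)| < (r.den : ℝ) ^ (-m)}.Infinite})

/- The ring `ℤ((z⁻¹))` is `LaurentSeries ℤ`, whose variable `HahnSeries.single 1 1` is read as
`z⁻¹`: the coefficient `g.coeff n` of a series `g` is its coefficient at `z ^ (-n)`. -/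

/-- The element `z` of `ℤ((z⁻¹))`. -/
def zVar : LaurentSeries ℤ := HahnSeries.single (-1 : ℤ) (1 : ℤ)

/-- Multiplication by `3` as an order embedding of `ℤ` into itself. -/
def mulThree : ℤ ↪o ℤ :=
  OrderEmbedding.ofStrictMono (fun n : ℤ => 3 * n) (fun _ _ h => by dsimp only; omega)

/-- The substitution `g(z) ↦ g(z ^ 3)` on `ℤ((z⁻¹))`. -/
def substCube (g : LaurentSeries ℤ) : LaurentSeries ℤ := HahnSeries.embDomain mulThree g

/-- `g(z)` solves the functional equation `g(z) = (z ^ 2 + a₁ z + a₂) g(z ^ 3)`. -/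
def SolvesMahlerEq (a₁ a₂ : ℤ) (g : LaurentSeries ℤ) : Prop :=
  g = (zVar ^ 2 + HahnSeries.C a₁ * zVar + HahnSeries.C a₂) * substCube g

/-- The term `g_n b ^ (-n)` of the series `g(b) = ∑ n, g_n b ^ (-n)`. -/
def valueTerm (g : LaurentSeries ℤ) (b : ℤ) (n : ℤ) : ℝ := (g.coeff n : ℝ) * (b : ℝ) ^ (-n)

/-- The value `g(b)` of the Laurent series `g` at `z = b`, as the sum of the series. -/
def valueAt (g : LaurentSeries ℤ) (b : ℤ) : ℝ := ∑' n : ℤ, valueTerm g b n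

end

open Filter Topology

/-- The recurrence satisfied by the coefficients of `∏ₜ (1 + a₁ x ^ 3 ^ t + a₂ x ^ (2 * 3 ^ t))`. -/
def IsMahlerSeq (a₁ a₂ : ℤ) (f : ℕ → ℤ) : Prop :=
  ∀ j, f (3 * j) = f j ∧ f (3 * j + 1) = a₁ * f j ∧ f (3 * j + 2) = a₂ * f j

theorem substCube_coeff (g : LaurentSeries ℤ) (k : ℤ) :
    (substCube g).coeff (3 * k) = g.coeff k :=
  HahnSeries.embDomain_coeff (f := mulThree) (x := g) (a := k)

theorem substCube_coeff_of_not_dvd (g : LaurentSeries ℤ) (m : ℤ) (h : ¬ (3 : ℤ) ∣ m) :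
    (substCube g).coeff m = 0 := by
  apply HahnSeries.embDomain_of_notMem_range
  rintro ⟨k, rfl⟩
  exact h ⟨k, rfl⟩

theorem SolvesMahlerEq.coeff_eq {a₁ a₂ : ℤ} {g : LaurentSeries ℤ} (h : SolvesMahlerEq a₁ a₂ g)
    (m : ℤ) : g.coeff m = (substCube g).coeff (m + 2) + a₁ * (substCube g).coeff (m + 1)
      + a₂ * (substCube g).coeff m := by
  have key : ∀ (r k : ℤ) (y : LaurentSeries ℤ),
      (HahnSeries.single (-k) r * y).coeff m = r * y.coeff (m + k) := by
    intro r k y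
    have := HahnSeries.coeff_single_mul_add (r := r) (x := y) (a := m + k) (b := -k)
    simpa using this
  have h1 : zVar ^ 2 = HahnSeries.single (-2 : ℤ) (1 : ℤ) := by
    rw [zVar, pow_two, HahnSeries.single_mul_single]; norm_num
  have h2 : HahnSeries.C a₁ * zVar = HahnSeries.single (-1 : ℤ) a₁ := by
    rw [zVar, HahnSeries.C_apply, HahnSeries.single_mul_single]; norm_num
  have h3 : (HahnSeries.C a₂ : LaurentSeries ℤ) = HahnSeries.single (-0 : ℤ) a₂ := by
    rw [HahnSeries.C_apply]; norm_num
  conv_lhs => rw [h]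
  rw [h1, h2, h3, add_mul, add_mul, HahnSeries.coeff_add, HahnSeries.coeff_add, key, key, key]
  simp

theorem SolvesMahlerEq.coeff_three_mul_sub_two {a₁ a₂ : ℤ} {g : LaurentSeries ℤ}
    (h : SolvesMahlerEq a₁ a₂ g) (k : ℤ) : g.coeff (3 * k - 2) = g.coeff k := by
  rw [h.coeff_eq, substCube_coeff_of_not_dvd _ (3 * k - 2 + 1) (by omega),
    substCube_coeff_of_not_dvd _ (3 * k - 2) (by omega), sub_add_cancel, substCube_coeff]
  ring

theorem SolvesMahlerEq.coeff_three_mul_sub_one {a₁ a₂ : ℤ} {g : LaurentSeries ℤ}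
    (h : SolvesMahlerEq a₁ a₂ g) (k : ℤ) : g.coeff (3 * k - 1) = a₁ * g.coeff k := by
  rw [h.coeff_eq, substCube_coeff_of_not_dvd _ (3 * k - 1 + 2) (by omega),
    substCube_coeff_of_not_dvd _ (3 * k - 1) (by omega), sub_add_cancel, substCube_coeff]
  ring

theorem SolvesMahlerEq.coeff_three_mul {a₁ a₂ : ℤ} {g : LaurentSeries ℤ}
    (h : SolvesMahlerEq a₁ a₂ g) (k : ℤ) : g.coeff (3 * k) = a₂ * g.coeff k := by
  rw [h.coeff_eq, substCube_coeff_of_not_dvd _ (3 * k + 2) (by omega),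
    substCube_coeff_of_not_dvd _ (3 * k + 1) (by omega), substCube_coeff]
  ring

theorem SolvesMahlerEq.coeff_nonpos {a₁ a₂ : ℤ} {g : LaurentSeries ℤ}
    (h : SolvesMahlerEq a₁ a₂ g) {m : ℤ} (hm : m ≤ 0) : g.coeff m = 0 := by
  have step : ∀ (n : ℕ) (m : ℤ), m ≤ 0 → m < g.order + n → g.coeff m = 0 := by
    intro n
    induction n with
    | zero =>
      intro m _ hlt
      exact HahnSeries.coeff_eq_zero_of_lt_order (by simpa using hlt)
    | succ n ih =>
      intro m hm hlt
      rw [← h.coeff_three_mul_sub_two]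
      exact ih _ (by omega) (by push_cast at hlt; omega)
  exact step (m - g.order + 1).toNat m hm (by omega)

theorem SolvesMahlerEq.isMahlerSeq {a₁ a₂ : ℤ} {g : LaurentSeries ℤ}
    (h : SolvesMahlerEq a₁ a₂ g) : IsMahlerSeq a₁ a₂ (fun n => g.coeff (n + 1)) := by
  intro j
  refine ⟨(congrArg _ ?_).trans (h.coeff_three_mul_sub_two (j + 1)),
    (congrArg _ ?_).trans (h.coeff_three_mul_sub_one (j + 1)),
    (congrArg _ ?_).trans (h.coeff_three_mul (j + 1))⟩ <;> push_cast <;> ring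

namespace IsMahlerSeq

variable {a₁ a₂ : ℤ} {f : ℕ → ℤ}

theorem exists_bound (h : IsMahlerSeq a₁ a₂ f) :
    ∃ (C : ℝ) (k : ℕ), ∀ n, |(f n : ℝ)| ≤ C * ((n : ℝ) + 1) ^ k := by
  set A : ℝ := 1 + |(a₁ : ℝ)| + |(a₂ : ℝ)| with hA
  have hA1 : 1 ≤ A := by rw [hA]; linarith [abs_nonneg (a₁ : ℝ), abs_nonneg (a₂ : ℝ)]
  have hA0 : 0 ≤ A := by linarith
  obtain ⟨k, hk⟩ := pow_unbounded_of_one_lt A (one_lt_two)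
  have step : ∀ j i, i < 3 → |(f (3 * j + i) : ℝ)| ≤ A * |(f j : ℝ)| := by
    intro j i hi
    obtain ⟨h0, h1, h2⟩ := h j
    have := abs_nonneg (f j : ℝ)
    interval_cases i
    · rw [add_zero, h0]; nlinarith
    · rw [h1]; push_cast; rw [abs_mul]
      exact mul_le_mul_of_nonneg_right (by linarith [abs_nonneg (a₂ : ℝ)]) this
    · rw [h2]; push_cast; rw [abs_mul]
      exact mul_le_mul_of_nonneg_right (by linarith [abs_nonneg (a₁ : ℝ)]) this
  refine ⟨A * |(f 0 : ℝ)|, k, fun n => ?_⟩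
  have hC : 0 ≤ A * |(f 0 : ℝ)| := by positivity
  induction n using Nat.strong_induction_on with
  | _ n ih =>
    have hs := step (n / 3) (n % 3) (Nat.mod_lt _ (by norm_num))
    rw [Nat.div_add_mod] at hs
    by_cases hn : n < 3
    · rw [Nat.div_eq_of_lt hn] at hs
      refine hs.trans (le_mul_of_one_le_right hC (one_le_pow₀ ?_))
      linarith [(Nat.cast_nonneg n : (0 : ℝ) ≤ n)]
    · have hi := ih (n / 3) (by omega)
      have hle : 2 * (((n / 3 : ℕ) : ℝ) + 1) ≤ (n : ℝ) + 1 := by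
        have : 2 * (n / 3 + 1) ≤ n + 1 := by omega
        exact_mod_cast this
      calc |(f n : ℝ)| ≤ A * |(f (n / 3) : ℝ)| := hs
        _ ≤ 2 ^ k * (A * |(f 0 : ℝ)| * (((n / 3 : ℕ) : ℝ) + 1) ^ k) :=
          mul_le_mul hk.le hi (abs_nonneg _) (by positivity)
        _ = A * |(f 0 : ℝ)| * (2 * (((n / 3 : ℕ) : ℝ) + 1)) ^ k := by rw [mul_pow]; ring
        _ ≤ _ := by gcongr

theorem summable (h : IsMahlerSeq a₁ a₂ f) (N : ℕ) {x : ℝ} (hx : |x| < 1) :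
    Summable (fun n : ℕ => (f (n + N) : ℝ) * x ^ n) := by
  obtain ⟨C, k, hC⟩ := h.exists_bound
  have hC0 : 0 ≤ C := by simpa using (abs_nonneg _).trans (hC 0)
  have h1 := (summable_pow_mul_geometric_of_norm_lt_one (R := ℝ) k (r := |x|) (by simpa using hx))
  have h2 : Summable (fun n : ℕ => C * ((N : ℝ) + 2) ^ k * (|x| ^ n + (n : ℝ) ^ k * |x| ^ n)) :=
    ((summable_geometric_of_lt_one (abs_nonneg x) hx).add h1).mul_left _
  refine Summable.of_norm_bounded h2 fun n => ?_
  have hn : ((n : ℝ) + N + 1) ^ k ≤ ((N : ℝ) + 2) ^ k * (1 + (n : ℝ) ^ k) := by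
    rcases Nat.eq_zero_or_pos n with rfl | hn
    · have : ((0 : ℕ) : ℝ) + N + 1 ≤ N + 2 := by norm_num
      calc (((0 : ℕ) : ℝ) + N + 1) ^ k ≤ ((N : ℝ) + 2) ^ k := by gcongr
        _ ≤ _ := le_mul_of_one_le_right (by positivity)
          (by linarith [show (0 : ℝ) ≤ ((0 : ℕ) : ℝ) ^ k by positivity])
    · have hn1 : (1 : ℝ) ≤ n := by exact_mod_cast hn
      have hN : (0 : ℝ) ≤ N := Nat.cast_nonneg N
      calc ((n : ℝ) + N + 1) ^ k ≤ (((N : ℝ) + 2) * n) ^ k := by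
            gcongr; nlinarith
        _ = ((N : ℝ) + 2) ^ k * (n : ℝ) ^ k := mul_pow _ _ _
        _ ≤ _ := by gcongr; linarith
  rw [norm_mul, norm_pow, Real.norm_eq_abs, Real.norm_eq_abs]
  calc |(f (n + N) : ℝ)| * |x| ^ n ≤ (C * (((N : ℝ) + 2) ^ k * (1 + (n : ℝ) ^ k))) * |x| ^ n := by
        gcongr
        refine (hC _).trans ?_
        push_cast
        gcongr
    _ = _ := by ring

end IsMahlerSeq

/-- The sum `∑ fₙ x ^ (n + 1)`. -/
noncomputable def mahlerSum (f : ℕ → ℤ) (x : ℝ) : ℝ := ∑' n : ℕ, (f n : ℝ) * x ^ (n + 1)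

/-- The sum of the tail `∑ f (n + N) x ^ n`. -/
noncomputable def mahlerTail (f : ℕ → ℤ) (N : ℕ) (x : ℝ) : ℝ := ∑' n : ℕ, (f (n + N) : ℝ) * x ^ n

namespace IsMahlerSeq

variable {a₁ a₂ : ℤ} {f : ℕ → ℤ}

theorem mahlerSum_eq_sum_add_tail (h : IsMahlerSeq a₁ a₂ f) (N : ℕ) {x : ℝ} (hx : |x| < 1) :
    mahlerSum f x = ∑ n ∈ Finset.range N, (f n : ℝ) * x ^ (n + 1)
      + x ^ (N + 1) * mahlerTail f N x := by
  have hs : Summable (fun n : ℕ => (f n : ℝ) * x ^ (n + 1)) := by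
    have := (h.summable 0 hx).mul_left x
    refine this.congr fun n => ?_
    simp only [add_zero]; ring
  rw [mahlerSum, ← hs.sum_add_tsum_nat_add N, mahlerTail, ← tsum_mul_left]
  congr 1
  refine tsum_congr fun n => ?_
  ring

theorem tendsto_mahlerTail (h : IsMahlerSeq a₁ a₂ f) (N : ℕ) :
    Tendsto (mahlerTail f N) (𝓝 0) (𝓝 (f N : ℝ)) := by
  have hb := (h.summable N (x := 1 / 2) (by norm_num [abs_of_pos])).norm
  have hlim : ∑' n : ℕ, (if n = 0 then (f N : ℝ) else 0) = f N := tsum_ite_eq 0 _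
  rw [← hlim]
  refine tendsto_tsum_of_dominated_convergence hb ?_ ?_
  · intro n
    have hc : Continuous (fun x : ℝ => (f (n + N) : ℝ) * x ^ n) := by fun_prop
    have := hc.tendsto 0
    rcases Nat.eq_zero_or_pos n with rfl | hn
    · simp
    · simpa only [hn.ne', if_false, zero_pow, ne_eq, not_false_eq_true, mul_zero] using this
  · filter_upwards [Metric.ball_mem_nhds (0 : ℝ) (by norm_num : (0 : ℝ) < 1 / 2)] with x hx n
    rw [norm_mul, norm_mul, norm_pow, norm_pow]
    have : ‖x‖ ≤ ‖(1 / 2 : ℝ)‖ := by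
      rw [mem_ball_zero_iff] at hx
      rw [Real.norm_of_nonneg (by norm_num : (0 : ℝ) ≤ 1 / 2)]; exact hx.le
    gcongr

theorem mahlerSum_functional (h : IsMahlerSeq a₁ a₂ f) {x : ℝ} (hx : |x| < 1) :
    x ^ 2 * mahlerSum f x = (1 + a₁ * x + a₂ * x ^ 2) * mahlerSum f (x ^ 3) := by
  have hx3 : |x ^ 3| < 1 := by rw [abs_pow]; exact pow_lt_one₀ (abs_nonneg _) hx (by norm_num)
  have e : ∀ y : ℝ, |y| < 1 → mahlerSum f y = y * ∑' n : ℕ, (f n : ℝ) * y ^ n := by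
    intro y hy
    rw [mahlerSum, ← tsum_mul_left]
    exact tsum_congr fun n => by ring
  have s1 := h.summable 0 hx
  have s3 := h.summable 0 hx3
  simp only [add_zero] at s1 s3
  have key : ∑' n : ℕ, (f n : ℝ) * x ^ n
      = (1 + a₁ * x + a₂ * x ^ 2) * ∑' n : ℕ, (f n : ℝ) * (x ^ 3) ^ n := by
    have h1 := (Nat.divModEquiv 3).symm.tsum_eq (fun n : ℕ => (f n : ℝ) * x ^ n)
    have h2 : Summable (fun c : ℕ × Fin 3 => (f ((Nat.divModEquiv 3).symm c) : ℝ) *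
        x ^ (Nat.divModEquiv 3).symm c) := (Nat.divModEquiv 3).symm.summable_iff.mpr s1
    rw [← h1, Summable.tsum_prod' h2 (fun b => (hasSum_fintype _).summable), ← tsum_mul_left]
    refine tsum_congr fun j => ?_
    obtain ⟨h0, h1, h2⟩ := h j
    rw [tsum_fintype, Fin.sum_univ_three]
    simp only [Nat.divModEquiv_symm_apply, Fin.val_zero, Fin.val_one, Fin.val_two]
    rw [mul_comm j 3, add_zero, h0, h1, h2]
    push_cast
    rw [← pow_mul]
    ring
  rw [e x hx, e _ hx3, key]
  ring

end IsMahlerSeq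

theorem valueTerm_succ (g : LaurentSeries ℤ) (b : ℤ) (n : ℕ) :
    valueTerm g b ((n : ℤ) + 1) = (g.coeff (n + 1) : ℝ) * ((b : ℝ)⁻¹) ^ (n + 1) := by
  rw [valueTerm, zpow_neg, inv_pow]
  norm_cast

theorem SolvesMahlerEq.valueTerm_support {a₁ a₂ : ℤ} {g : LaurentSeries ℤ}
    (h : SolvesMahlerEq a₁ a₂ g) (b : ℤ) (m : ℤ)
    (hm : m ∉ Set.range (fun n : ℕ => (n : ℤ) + 1)) : valueTerm g b m = 0 := by
  rw [valueTerm, h.coeff_nonpos, Int.cast_zero, zero_mul]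
  by_contra hlt
  exact hm ⟨(m - 1).toNat, by simp only; omega⟩

theorem natCast_add_one_injective : Function.Injective (fun n : ℕ => (n : ℤ) + 1) := by
  intro m n hmn
  simpa using hmn

theorem abs_inv_intCast_lt_one {b : ℤ} (hb : 2 ≤ |b|) : |((b : ℝ)⁻¹)| < 1 := by
  rw [abs_inv]
  apply inv_lt_one_of_one_lt₀
  have : (2 : ℝ) ≤ |(b : ℝ)| := by exact_mod_cast hb
  linarith

theorem SolvesMahlerEq.summable_valueTerm {a₁ a₂ : ℤ} {g : LaurentSeries ℤ}
    (h : SolvesMahlerEq a₁ a₂ g) {b : ℤ} (hb : 2 ≤ |b|) : Summable (valueTerm g b) := by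
  rw [← natCast_add_one_injective.summable_iff (h.valueTerm_support b)]
  refine ((h.isMahlerSeq.summable 0 (abs_inv_intCast_lt_one hb)).mul_left (b : ℝ)⁻¹).congr ?_
  intro n
  rw [Function.comp_apply, valueTerm_succ]
  simp only [add_zero]
  ring

theorem SolvesMahlerEq.valueAt_eq {a₁ a₂ : ℤ} {g : LaurentSeries ℤ}
    (h : SolvesMahlerEq a₁ a₂ g) (b : ℤ) :
    valueAt g b = mahlerSum (fun n => g.coeff (n + 1)) (b : ℝ)⁻¹ := by
  rw [valueAt, mahlerSum, ← natCast_add_one_injective.tsum_eq]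
  · exact tsum_congr fun n => valueTerm_succ g b n
  · intro m hm
    by_contra hc
    exact hm (h.valueTerm_support b m hc)

/-- Reduced fractions `pₙ / qₙ` with `|qₙ| ≈ exp (d L 3 ^ n)` and `|qₙ ξ - pₙ| ≈ exp (-e L 3 ^ n)`,
up to factors `exp (o (3 ^ n))`. -/
def ApproxFamily (ξ L d e : ℝ) : Prop :=
  ∃ p q : ℕ → ℤ, (∀ᶠ n in atTop, IsCoprime (p n) (q n)) ∧
    Tendsto (fun n => Real.log |(q n : ℝ)| / 3 ^ n) atTop (𝓝 (d * L)) ∧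
    Tendsto (fun n => Real.log |(q n : ℝ) * ξ - p n| / 3 ^ n) atTop (𝓝 (-(e * L)))

theorem ApproxFamily.shift {ξ L d e : ℝ} (h : ApproxFamily ξ L d e) :
    ApproxFamily ξ L (3 * d) (3 * e) := by
  obtain ⟨p, q, hc, hq, hp⟩ := h
  refine ⟨fun n => p (n + 1), fun n => q (n + 1), (tendsto_add_atTop_nat 1).eventually hc, ?_, ?_⟩
  · convert (hq.comp (tendsto_add_atTop_nat 1)).const_mul 3 using 2 with n
    · simp only [Function.comp_apply, pow_succ]; field_simp
    · ring
  · convert (hp.comp (tendsto_add_atTop_nat 1)).const_mul 3 using 2 with n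
    · simp only [Function.comp_apply, pow_succ]; field_simp
    · ring

theorem Irrational.intCast_mul_sub_ne_zero {ξ : ℝ} (hξ : Irrational ξ) {p q : ℤ} (hq : q ≠ 0) :
    (q : ℝ) * ξ - p ≠ 0 := by
  intro h
  have hq' : (q : ℝ) ≠ 0 := by exact_mod_cast hq
  apply hξ
  refine ⟨(p : ℚ) / q, ?_⟩
  push_cast
  rw [div_eq_iff hq']
  linarith

theorem ApproxFamily.infinite {ξ L d e m : ℝ} (hξ : Irrational ξ) (hL : 0 < L) (hd : 0 < d)
    (he : 0 < e) (h : ApproxFamily ξ L d e) (hm1 : 1 ≤ m) (hm : m < 1 + e / d) :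
    {r : ℚ | |ξ - (r : ℝ)| < (r.den : ℝ) ^ (-m)}.Infinite := by
  obtain ⟨p, q, -, hq, hp⟩ := h
  have hpow : Tendsto (fun n : ℕ => (3 : ℝ) ^ n) atTop atTop :=
    tendsto_pow_atTop_atTop_of_one_lt (by norm_num)
  have hq0 : ∀ᶠ n in atTop, q n ≠ 0 := by
    filter_upwards [hq.eventually_const_lt (mul_pos hd hL)] with n hn h0
    simp [h0] at hn
  have hε : Tendsto (fun n => |(q n : ℝ) * ξ - p n|) atTop (𝓝 0) := by
    have h1 := Real.tendsto_exp_atBot.comp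
      (hp.neg_mul_atTop (neg_neg_of_pos (mul_pos he hL)) hpow)
    refine h1.congr' ?_
    filter_upwards [hq0] with n hn
    rw [Function.comp_apply, div_mul_cancel₀ _ (by positivity),
      Real.exp_log (abs_pos.mpr (hξ.intCast_mul_sub_ne_zero hn))]
  have herr : ∀ n, q n ≠ 0 →
      |ξ - (((p n : ℚ) / q n : ℚ) : ℝ)| = |(q n : ℝ) * ξ - p n| / |(q n : ℝ)| := by
    intro n hn
    have hn' : (q n : ℝ) ≠ 0 := by exact_mod_cast hn
    rw [← abs_div]
    push_cast
    congr 1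
    field_simp
  have hlim : Tendsto (fun n => (((p n : ℚ) / q n : ℚ) : ℝ)) atTop (𝓝 ξ) := by
    rw [tendsto_iff_dist_tendsto_zero]
    refine squeeze_zero' (Eventually.of_forall fun _ => dist_nonneg) ?_ hε
    filter_upwards [hq0] with n hn
    rw [dist_comm, Real.dist_eq, herr n hn]
    apply div_le_self (abs_nonneg _)
    exact_mod_cast Int.one_le_abs hn
  have hmem : ∀ᶠ n in atTop, |ξ - (((p n : ℚ) / q n : ℚ) : ℝ)|
      < ((((p n : ℚ) / q n : ℚ).den : ℕ) : ℝ) ^ (-m) := by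
    have hneg : (m - 1) * (d * L) + -(e * L) < 0 := by
      have : (m - 1) * d < e := by
        rw [← lt_div_iff₀ hd]; linarith
      nlinarith
    filter_upwards [hq0, ((hq.const_mul (m - 1)).add hp).eventually_lt_const hneg] with n hn hlt
    have hqpos : 0 < |(q n : ℝ)| := abs_pos.mpr (by exact_mod_cast hn)
    have hpos : 0 < |(q n : ℝ) * ξ - p n| := abs_pos.mpr (hξ.intCast_mul_sub_ne_zero hn)
    rw [herr n hn]
    have hden : ((((p n : ℚ) / q n : ℚ).den : ℕ) : ℝ) ≤ |(q n : ℝ)| := by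
      have h1 := Int.le_of_dvd (abs_pos.mpr hn) ((dvd_abs _ _).mpr (Rat.den_dvd (p n) (q n)))
      exact_mod_cast h1
    have hden0 : (0 : ℝ) < ((((p n : ℚ) / q n : ℚ).den : ℕ) : ℝ) := by
      exact_mod_cast Rat.den_pos _
    refine lt_of_lt_of_le ?_ (Real.rpow_le_rpow_of_nonpos hden0 hden (by linarith))
    rw [← Real.log_lt_log_iff (by positivity) (by positivity),
      Real.log_div hpos.ne' hqpos.ne', Real.log_rpow hqpos]
    have h3 : (0 : ℝ) < 3 ^ n := by positivity
    rw [← mul_div_assoc, ← add_div, div_lt_iff₀ h3, zero_mul] at hlt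
    linarith
  intro hfin
  have hopen := (hfin.image (fun r : ℚ => (r : ℝ))).isClosed.isOpen_compl.mem_nhds
    (show ξ ∈ _ from fun ⟨r, _, hr⟩ => hξ ⟨r, hr⟩)
  obtain ⟨n, h1, h2⟩ := (hmem.and (hlim.eventually hopen)).exists
  exact h2 ⟨_, h1, rfl⟩

theorem ApproxFamily.le_irrationalityExponent {ξ L d e : ℝ} (hξ : Irrational ξ) (hL : 0 < L)
    (hd : 0 < d) (he : 0 < e) (h : ApproxFamily ξ L d e) :
    ((1 + e / d : ℝ) : EReal) ≤ irrationalityExponent ξ := by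
  refine le_of_forall_lt fun c hc => ?_
  obtain ⟨m, hcm, hm⟩ := EReal.lt_iff_exists_real_btwn.mp hc
  have hm' : max m 1 < 1 + e / d :=
    max_lt (EReal.coe_lt_coe_iff.mp hm) (by linarith [div_pos he hd])
  refine lt_of_lt_of_le (hcm.trans_le (EReal.coe_le_coe_iff.mpr (le_max_left m 1))) ?_
  exact le_sSup ⟨_, h.infinite hξ hL hd he (le_max_right _ _) hm', rfl⟩

/-- There is a reduced fraction `p / q` with `|q ξ - p| ≤ exp (-Y)` and `|q| ≤ exp (τ Y)` that is
not better than of exponent `τ`. -/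
def HasApprox (ξ τ Y : ℝ) : Prop :=
  ∃ p q : ℤ, IsCoprime p q ∧ q ≠ 0 ∧ Real.log |(q : ℝ)| ≤ τ * Y ∧
    Real.log |(q : ℝ) * ξ - p| ≤ -Y ∧ -(τ * Real.log |(q : ℝ)|) ≤ Real.log |(q : ℝ) * ξ - p|

theorem HasApprox.lower_bound {ξ τ : ℝ} (hξ : Irrational ξ) (hτ : 0 < τ) {p q : ℤ} (hq : 0 < q)
    (hpq : IsCoprime p q) (h : HasApprox ξ τ (Real.log (2 * q))) :
    -Real.log 2 - τ * Real.log (2 * q) ≤ Real.log |(q : ℝ) * ξ - p| := by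
  obtain ⟨p', q', hc, hq', h1, h2, h3⟩ := h
  have hqR : (1 : ℝ) ≤ q := by exact_mod_cast hq
  have hlog2 : 0 < Real.log 2 := Real.log_pos (by norm_num)
  have hlogq : Real.log (2 * q) = Real.log 2 + Real.log q :=
    Real.log_mul (by norm_num) (by linarith)
  by_cases heq : p * q' = q * p'
  · have d1 : q ∣ q' := hpq.symm.dvd_of_dvd_mul_left ⟨p', heq⟩
    have d2 : q' ∣ q := hc.symm.dvd_of_dvd_mul_right ⟨p, by linarith⟩
    have hlower : -(τ * Real.log q) ≤ Real.log |(q : ℝ) * ξ - p| := by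
      rcases Int.natAbs_eq_natAbs_iff.mp (Nat.dvd_antisymm (Int.natAbs_dvd_natAbs.mpr d2)
        (Int.natAbs_dvd_natAbs.mpr d1)) with h | h
      · subst h
        obtain rfl : p = p' := mul_right_cancel₀ hq' (by linarith)
        rwa [abs_of_pos (by linarith)] at h3
      · subst h
        obtain rfl : p = -p' := mul_right_cancel₀ hq.ne' (by linarith)
        push_cast at h3 ⊢
        rw [abs_neg, abs_of_pos (by linarith)] at h3
        rwa [← abs_neg, show -((q : ℝ) * ξ - -(p' : ℝ)) = -(q : ℝ) * ξ - p' by ring]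
    nlinarith
  · have hne : (1 : ℝ) ≤ |(p : ℝ) * q' - q * p'| := by
      exact_mod_cast Int.one_le_abs (sub_ne_zero.mpr heq)
    have hpos' : 0 < |(q' : ℝ) * ξ - p'| := abs_pos.mpr (hξ.intCast_mul_sub_ne_zero hq')
    have hpos : 0 < |(q : ℝ) * ξ - p| := abs_pos.mpr (hξ.intCast_mul_sub_ne_zero hq.ne')
    have hq'pos : 0 < |(q' : ℝ)| := abs_pos.mpr (by exact_mod_cast hq')
    have hsmall : (q : ℝ) * |(q' : ℝ) * ξ - p'| ≤ 1 / 2 := by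
      have := (Real.log_le_iff_le_exp hpos').mp h2
      rw [Real.exp_neg, Real.exp_log (by linarith)] at this
      calc (q : ℝ) * |(q' : ℝ) * ξ - p'| ≤ q * (2 * (q : ℝ))⁻¹ := by gcongr
        _ = 1 / 2 := by field_simp
    have htri : |(p : ℝ) * q' - q * p'|
        ≤ |(q' : ℝ)| * |(q : ℝ) * ξ - p| + q * |(q' : ℝ) * ξ - p'| := by
      have e : (p : ℝ) * q' - q * p' = -(q' * (q * ξ - p)) + q * (q' * ξ - p') := by ring
      rw [e]
      refine (abs_add_le _ _).trans ?_
      rw [abs_neg, abs_mul, abs_mul, abs_of_pos (by linarith : (0 : ℝ) < q)]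
    have hprod : (2 : ℝ)⁻¹ ≤ |(q' : ℝ)| * |(q : ℝ) * ξ - p| := by linarith
    have := Real.log_le_log (by norm_num) hprod
    rw [Real.log_inv, Real.log_mul hq'pos.ne' hpos.ne'] at this
    linarith

theorem finite_rat_den_le (ξ : ℝ) (N : ℝ) :
    {r : ℚ | (r.den : ℝ) ≤ N ∧ |ξ - (r : ℝ)| < 1}.Finite := by
  have hinj : Set.InjOn (fun r : ℚ => (r.num, (r.den : ℤ)))
      {r : ℚ | (r.den : ℝ) ≤ N ∧ |ξ - (r : ℝ)| < 1} := by
    intro r _ s _ hrs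
    simp only [Prod.mk.injEq, Nat.cast_inj] at hrs
    exact Rat.ext hrs.1 hrs.2
  refine Set.Finite.of_finite_image ?_ hinj
  refine ((Set.finite_Icc (-⌈N * (|ξ| + 1)⌉) ⌈N * (|ξ| + 1)⌉).prod
    (Set.finite_Icc 0 ⌈N⌉)).subset ?_
  rintro _ ⟨r, ⟨h1, h2⟩, rfl⟩
  have hden : (0 : ℝ) < r.den := by exact_mod_cast r.den_pos
  have hN : 0 ≤ N := hden.le.trans h1
  have hnum : |(r.num : ℝ)| ≤ N * (|ξ| + 1) := by
    have hr : (r.num : ℝ) = r.den * (r : ℝ) := by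
      exact_mod_cast (Rat.den_mul_eq_num r).symm
    rw [hr, abs_mul, abs_of_pos hden]
    have : |(r : ℝ)| ≤ |ξ| + 1 := by
      have := abs_sub_abs_le_abs_sub (r : ℝ) ξ
      rw [abs_sub_comm] at this
      linarith
    gcongr
  have hnum' := abs_le.mp hnum
  refine Set.mk_mem_prod ⟨?_, ?_⟩ ⟨by positivity, ?_⟩
  · have : -(r.num : ℝ) ≤ ⌈N * (|ξ| + 1)⌉ := (by linarith : -(r.num : ℝ) ≤ _).trans (Int.le_ceil _)
    have : -r.num ≤ ⌈N * (|ξ| + 1)⌉ := by exact_mod_cast this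
    linarith
  · exact_mod_cast hnum'.2.trans (Int.le_ceil _)
  · exact_mod_cast h1.trans (Int.le_ceil _)

theorem irrationalityExponent_le_of_hasApprox {ξ τ : ℝ} (hξ : Irrational ξ) (hτ : 0 < τ)
    (h : ∃ Y₀, ∀ Y, Y₀ ≤ Y → HasApprox ξ τ Y) :
    irrationalityExponent ξ ≤ ((1 + τ : ℝ) : EReal) := by
  obtain ⟨Y₀, hY⟩ := h
  refine sSup_le ?_
  rintro _ ⟨m, hm, rfl⟩
  rw [EReal.coe_le_coe_iff]
  by_contra! hlt
  rw [Set.mem_ofPred_eq] at hm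
  refine hm ((finite_rat_den_le ξ
    (Real.exp (max Y₀ ((1 + τ) * Real.log 2 / (m - 1 - τ))))).subset ?_)
  intro r hr
  rw [Set.mem_ofPred_eq] at hr
  have hden : (1 : ℝ) ≤ r.den := by exact_mod_cast r.den_pos
  refine ⟨?_, hr.trans_le (Real.rpow_le_one_of_one_le_of_nonpos hden (by linarith))⟩
  by_contra! hbig
  have hlog := (Real.lt_log_iff_exp_lt (by linarith)).mpr hbig
  have hlog2 : 0 < Real.log 2 := Real.log_pos (by norm_num)
  have hdpos : (0 : ℤ) < (r.den : ℤ) := by exact_mod_cast r.den_pos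
  have hcop : IsCoprime r.num (r.den : ℤ) := Rat.isCoprime_num_den r
  have hl : Real.log (2 * (r.den : ℝ)) = Real.log 2 + Real.log r.den :=
    Real.log_mul (by norm_num) (by linarith)
  have key := HasApprox.lower_bound hξ hτ hdpos hcop (hY _ (by
    push_cast
    rw [hl]
    linarith [le_max_left Y₀ ((1 + τ) * Real.log 2 / (m - 1 - τ))]))
  have hne := hξ.intCast_mul_sub_ne_zero (p := r.num) hdpos.ne'
  push_cast at key hne
  have hrr : ξ - (r : ℝ) = ((r.den : ℝ) * ξ - r.num) / r.den := by
    have : (r : ℝ) = r.num / r.den := by exact_mod_cast (Rat.num_div_den r).symm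
    rw [this]
    field_simp
  rw [hrr, abs_div, abs_of_pos (by linarith : (0 : ℝ) < r.den),
    ← Real.log_lt_log_iff (div_pos (abs_pos.mpr hne) (by linarith)) (by positivity),
    Real.log_div (abs_pos.mpr hne).ne' (by linarith), Real.log_rpow (by linarith)] at hr
  have h2 := (div_lt_iff₀ (by linarith)).mp ((le_max_right Y₀ _).trans_lt hlog)
  rw [hl] at key
  nlinarith

theorem ApproxFamily.eventually_hasApprox {ξ L d e τ lo hi : ℝ} (hL : 0 < L) (hd : 0 < d)
    (hτ : 0 < τ) (h : ApproxFamily ξ L d e) (hlo : d < τ * lo) (hhi : hi < e) (hde : e < τ * d) :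
    ∀ᶠ n : ℕ in atTop, ∀ Y, lo * L * 3 ^ n ≤ Y → Y ≤ hi * L * 3 ^ n → HasApprox ξ τ Y := by
  obtain ⟨p, q, hc, hq, hp⟩ := h
  filter_upwards [hc, hq.eventually_const_lt (mul_pos hd hL),
    hq.eventually_lt_const (show d * L < τ * lo * L by nlinarith),
    hp.eventually_lt_const (show -(e * L) < -(hi * L) by nlinarith),
    (hp.add (hq.const_mul τ)).eventually_const_lt (show 0 < -(e * L) + τ * (d * L) by nlinarith)]
    with n h1 h2 h3 h4 h5 Y hY1 hY2
  have h3n : (0 : ℝ) < 3 ^ n := by positivity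
  rw [div_lt_iff₀ h3n] at h3 h4
  rw [← mul_div_assoc, ← add_div, lt_div_iff₀ h3n, zero_mul] at h5
  refine ⟨p n, q n, h1, ?_, ?_, by linarith, by linarith⟩
  · intro h0
    simp [h0] at h2
  · nlinarith

theorem exists_forall_of_eventually_interval {P : ℝ → Prop} {lo L : ℝ} (hlo : 0 < lo) (hL : 0 < L)
    (h : ∀ᶠ n : ℕ in atTop, ∀ Y, lo * L * 3 ^ n ≤ Y → Y ≤ 3 * lo * L * 3 ^ n → P Y) :
    ∃ Y₀, ∀ Y, Y₀ ≤ Y → P Y := by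
  obtain ⟨n₀, hn₀⟩ := eventually_atTop.mp h
  refine ⟨lo * L * 3 ^ n₀, fun Y hY => ?_⟩
  have hpos : 0 < lo * L := mul_pos hlo hL
  have hY' : (3 : ℝ) ^ n₀ ≤ Y / (lo * L) := by rw [le_div_iff₀ hpos]; linarith
  obtain ⟨n, h1, h2⟩ := exists_nat_pow_near ((one_le_pow₀ (by norm_num)).trans hY')
    (by norm_num : (1 : ℝ) < 3)
  have hn : n₀ ≤ n :=
    Nat.lt_succ_iff.mp ((pow_lt_pow_iff_right₀ (by norm_num : (1 : ℝ) < 3)).mp (hY'.trans_lt h2))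
  rw [le_div_iff₀ hpos] at h1
  rw [div_lt_iff₀ hpos, pow_succ] at h2
  exact hn₀ n hn Y (by linarith) (by linarith)

theorem irrationalityExponent_le_of_forall_gt {ξ τ₀ : ℝ}
    (h : ∀ τ, τ₀ < τ → irrationalityExponent ξ ≤ ((1 + τ : ℝ) : EReal)) :
    irrationalityExponent ξ ≤ ((1 + τ₀ : ℝ) : EReal) := by
  refine le_of_forall_gt fun c hc => ?_
  obtain ⟨m, hm, hmc⟩ := EReal.lt_iff_exists_real_btwn.mp hc
  have := h (m - 1) (by linarith [EReal.coe_lt_coe_iff.mp hm])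
  rw [add_sub_cancel] at this
  exact this.trans_lt hmc

/-- The partial product `∏ (z ^ 2 + a₁ z + a₂)` over `z = b ^ 3 ^ t` with `t < n`. -/
def mahlerProd (a₁ a₂ b : ℤ) (n : ℕ) : ℤ :=
  ∏ t ∈ Finset.range n, ((b ^ 3 ^ t) ^ 2 + a₁ * b ^ 3 ^ t + a₂)

theorem tendsto_log_abs_div_pow_three {v : ℕ → ℝ} {κ : ℝ} (hκ : κ ≠ 0)
    (hv : Tendsto v atTop (𝓝 κ)) :
    Tendsto (fun n => Real.log |v n| / 3 ^ n) atTop (𝓝 0) :=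
  (hv.abs.log (abs_ne_zero.mpr hκ)).div_atTop
    (tendsto_pow_atTop_atTop_of_one_lt (by norm_num))

theorem tendsto_mul_pow_half_div :
    Tendsto (fun n : ℕ => (n : ℝ) * 3 ^ (n / 2) / 3 ^ n) atTop (𝓝 0) := by
  have h3 : Real.sqrt 3 * Real.sqrt 3 = 3 := Real.mul_self_sqrt (by norm_num)
  have h1 : 1 ≤ Real.sqrt 3 := Real.one_le_sqrt.mpr (by norm_num)
  have hlt : Real.sqrt 3 / 3 < 1 := by nlinarith
  refine squeeze_zero (fun n => by positivity) (fun n => ?_)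
    (tendsto_self_mul_const_pow_of_lt_one (by positivity) hlt)
  rw [div_pow, mul_div_assoc]
  gcongr
  calc (3 : ℝ) ^ (n / 2) = Real.sqrt 3 ^ (2 * (n / 2)) := by rw [pow_mul, pow_two, h3]
    _ ≤ Real.sqrt 3 ^ n := pow_le_pow_right₀ h1 (by omega)

theorem gcd_prod_le {ι : Type*} (s : Finset ι) (F : ι → ℤ) (x : ℤ) (B : ℕ)
    (hF : ∀ i ∈ s, F i ≠ 0) (hB : ∀ i ∈ s, Int.gcd x (F i) ≤ B) :
    Int.gcd x (∏ i ∈ s, F i) ≤ B ^ s.card := by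
  classical
  induction s using Finset.induction_on with
  | empty => simp
  | insert a s ha ih =>
    rw [Finset.prod_insert ha, Finset.card_insert_of_notMem ha, pow_succ']
    have hpos : 0 < Int.gcd x (F a) * Int.gcd x (∏ i ∈ s, F i) := by
      refine Nat.mul_pos (Int.gcd_pos_of_ne_zero_right _ (hF a (Finset.mem_insert_self a s)))
        (Int.gcd_pos_of_ne_zero_right _ (Finset.prod_ne_zero_iff.mpr fun i hi =>
          hF i (Finset.mem_insert_of_mem hi)))
    exact (Nat.le_of_dvd hpos (Int.gcd_mul_right_dvd_mul_gcd _ _ _)).trans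
      (Nat.mul_le_mul (hB a (Finset.mem_insert_self a s))
        (ih (fun i hi => hF i (Finset.mem_insert_of_mem hi))
          (fun i hi => hB i (Finset.mem_insert_of_mem hi))))

theorem gcd_mahlerProd_le {a₁ a₂ b : ℤ} (hb : 2 ≤ |b|)
    (hP : ∀ n, mahlerProd a₁ a₂ b n ≠ 0) {q : ℕ → ℤ} {K : ℕ}
    (hK : ∀ n t, t < n → Int.gcd (q n) ((b ^ 3 ^ t) ^ 2 + a₁ * b ^ 3 ^ t + a₂) ≤ K ^ 3 ^ (n - t)) :
    ∃ C : ℕ, 1 ≤ C ∧ ∀ n, Int.gcd (q n) (mahlerProd a₁ a₂ b n) ≤ C ^ (n * 3 ^ (n / 2)) := by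
  set A : ℕ := (1 + a₁.natAbs + a₂.natAbs) * b.natAbs ^ 2 with hA
  have hb1 : 1 ≤ b.natAbs := Int.natAbs_pos.mpr (by rintro rfl; norm_num at hb)
  have hne : ∀ t, (b ^ 3 ^ t) ^ 2 + a₁ * b ^ 3 ^ t + a₂ ≠ 0 := fun t =>
    Finset.prod_ne_zero_iff.mp (hP (t + 1)) t (Finset.self_mem_range_succ t)
  have hbound : ∀ t, ((b ^ 3 ^ t) ^ 2 + a₁ * b ^ 3 ^ t + a₂).natAbs ≤ A ^ 3 ^ t := by
    intro t
    set X : ℕ := b.natAbs ^ 3 ^ t with hX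
    have hX1 : 1 ≤ X := Nat.one_le_pow _ _ hb1
    calc ((b ^ 3 ^ t) ^ 2 + a₁ * b ^ 3 ^ t + a₂).natAbs
        ≤ X ^ 2 + a₁.natAbs * X + a₂.natAbs := by
          refine (Int.natAbs_add_le _ _).trans (Nat.add_le_add_right ?_ _)
          refine (Int.natAbs_add_le _ _).trans (le_of_eq ?_)
          rw [Int.natAbs_mul, Int.natAbs_pow, Int.natAbs_pow]
      _ ≤ (1 + a₁.natAbs + a₂.natAbs) * X ^ 2 := by
          have h1 : X ≤ X ^ 2 := by nlinarith
          have h2 : 1 ≤ X ^ 2 := hX1.trans h1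
          nlinarith [Nat.zero_le a₁.natAbs, Nat.zero_le a₂.natAbs,
            Nat.mul_le_mul_left a₁.natAbs h1, Nat.mul_le_mul_left a₂.natAbs h2]
      _ ≤ (1 + a₁.natAbs + a₂.natAbs) ^ 3 ^ t * X ^ 2 := by
          gcongr
          exact Nat.le_self_pow (by positivity) _
      _ = A ^ 3 ^ t := by rw [hA, hX, mul_pow, ← pow_mul, ← pow_mul, mul_comm 2]
  refine ⟨max 1 (max A K), le_max_left _ _, fun n => ?_⟩
  set C := max 1 (max A K) with hC
  have hC1 : 1 ≤ C := le_max_left _ _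
  rw [mul_comm n, pow_mul]
  have := gcd_prod_le (Finset.range n) (fun t => (b ^ 3 ^ t) ^ 2 + a₁ * b ^ 3 ^ t + a₂) (q n)
    (C ^ 3 ^ (n / 2)) (fun t _ => hne t) ?_
  · rwa [Finset.card_range] at this
  · intro t ht
    have htn := Finset.mem_range.mp ht
    have hpow : ∀ j, j ≤ n / 2 → C ^ 3 ^ j ≤ C ^ 3 ^ (n / 2) := fun j hj =>
      Nat.pow_le_pow_right hC1 (Nat.pow_le_pow_right (by norm_num) hj)
    by_cases h : t ≤ n / 2
    · refine (Int.gcd_le_natAbs_right _ (hne t)).trans ((hbound t).trans ?_)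
      exact (Nat.pow_le_pow_left ((le_max_left _ _).trans (le_max_right _ _)) _).trans (hpow t h)
    · refine (hK n t htn).trans ?_
      exact (Nat.pow_le_pow_left ((le_max_right _ _).trans (le_max_right _ _)) _).trans
        (hpow (n - t) (by omega))

theorem tendsto_log_gcd {a₁ a₂ b : ℤ} (hb : 2 ≤ |b|)
    (hP : ∀ n, mahlerProd a₁ a₂ b n ≠ 0) {p q : ℕ → ℤ} (hq : ∀ᶠ n in atTop, q n ≠ 0) {K : ℕ}
    (hK : ∀ n t, t < n → Int.gcd (q n) ((b ^ 3 ^ t) ^ 2 + a₁ * b ^ 3 ^ t + a₂) ≤ K ^ 3 ^ (n - t))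
    {M : ℕ} (hM : ∀ n, Int.gcd (q n) (p n) ≤ M) :
    Tendsto (fun n => Real.log (Int.gcd (q n) (p n * mahlerProd a₁ a₂ b n)) / 3 ^ n)
      atTop (𝓝 0) := by
  obtain ⟨C, hC1, hC⟩ := gcd_mahlerProd_le hb hP hK
  have hlim : Tendsto (fun n : ℕ => Real.log (M + 1) / 3 ^ n
      + Real.log C * ((n : ℝ) * 3 ^ (n / 2) / 3 ^ n)) atTop (𝓝 0) := by
    have h1 : Tendsto (fun n : ℕ => Real.log (M + 1) / (3 : ℝ) ^ n) atTop (𝓝 0) :=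
      tendsto_const_nhds.div_atTop (tendsto_pow_atTop_atTop_of_one_lt (by norm_num))
    simpa using h1.add (tendsto_mul_pow_half_div.const_mul (Real.log C))
  refine squeeze_zero' (Eventually.of_forall fun n =>
    div_nonneg (Real.log_natCast_nonneg _) (by positivity)) ?_ hlim
  filter_upwards [hq] with n hn
  have hg : Int.gcd (q n) (p n * mahlerProd a₁ a₂ b n) ≤ (M + 1) * C ^ (n * 3 ^ (n / 2)) := by
    refine (Nat.le_of_dvd ?_ (Int.gcd_mul_right_dvd_mul_gcd _ _ _)).trans
      (Nat.mul_le_mul ((hM n).trans (Nat.le_succ M)) (hC n))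
    exact Nat.mul_pos (Int.gcd_pos_of_ne_zero_left _ hn) (Int.gcd_pos_of_ne_zero_left _ hn)
  have hpos : 0 < Int.gcd (q n) (p n * mahlerProd a₁ a₂ b n) := Int.gcd_pos_of_ne_zero_left _ hn
  have hlog := Real.log_le_log (by exact_mod_cast hpos)
    (show ((Int.gcd (q n) (p n * mahlerProd a₁ a₂ b n) : ℕ) : ℝ)
      ≤ ((M : ℝ) + 1) * (C : ℝ) ^ (n * 3 ^ (n / 2)) by exact_mod_cast hg)
  rw [Real.log_mul (by positivity) (by positivity), Real.log_pow] at hlog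
  rw [mul_div_assoc', ← add_div]
  gcongr
  refine hlog.trans (le_of_eq ?_)
  push_cast
  ring

theorem ApproxFamily.of_gcd {ξ L d e : ℝ} {p q : ℕ → ℤ} (hq0 : ∀ᶠ n in atTop, q n ≠ 0)
    (hne : ∀ᶠ n in atTop, (q n : ℝ) * ξ - p n ≠ 0)
    (hq : Tendsto (fun n => Real.log |(q n : ℝ)| / 3 ^ n) atTop (𝓝 (d * L)))
    (hp : Tendsto (fun n => Real.log |(q n : ℝ) * ξ - p n| / 3 ^ n) atTop (𝓝 (-(e * L))))
    (hg : Tendsto (fun n => Real.log (Int.gcd (q n) (p n)) / 3 ^ n) atTop (𝓝 0)) :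
    ApproxFamily ξ L d e := by
  have hpe : ∀ n, (p n : ℝ) = ((p n / Int.gcd (q n) (p n) : ℤ) : ℝ) * (Int.gcd (q n) (p n) : ℕ) :=
    fun n => by exact_mod_cast (Int.ediv_mul_cancel (Int.gcd_dvd_right (q n) (p n))).symm
  have hqe : ∀ n, (q n : ℝ) = ((q n / Int.gcd (q n) (p n) : ℤ) : ℝ) * (Int.gcd (q n) (p n) : ℕ) :=
    fun n => by exact_mod_cast (Int.ediv_mul_cancel (Int.gcd_dvd_left (q n) (p n))).symm
  refine ⟨fun n => p n / Int.gcd (q n) (p n), fun n => q n / Int.gcd (q n) (p n), ?_, ?_, ?_⟩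
  · filter_upwards [hq0] with n hn
    rw [isCoprime_comm, Int.isCoprime_iff_gcd_eq_one]
    exact Int.gcd_ediv_gcd_ediv_gcd (Int.gcd_pos_of_ne_zero_left _ hn)
  · have := hq.sub hg
    rw [sub_zero] at this
    refine this.congr' ?_
    filter_upwards [hq0] with n hn
    have hgpos : (0 : ℝ) < (Int.gcd (q n) (p n) : ℕ) := by
      exact_mod_cast Int.gcd_pos_of_ne_zero_left (p n) hn
    have hn' : (q n : ℝ) ≠ 0 := by exact_mod_cast hn
    rw [← sub_div]
    congr 1
    conv_lhs => rw [hqe n]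
    rw [hqe n] at hn'
    rw [abs_mul, Real.log_mul (abs_ne_zero.mpr (left_ne_zero_of_mul hn')) (by positivity),
      abs_of_pos hgpos]
    ring
  · have := hp.sub hg
    rw [sub_zero] at this
    refine this.congr' ?_
    filter_upwards [hq0, hne] with n hn hn'
    have hgpos : (0 : ℝ) < (Int.gcd (q n) (p n) : ℕ) := by
      exact_mod_cast Int.gcd_pos_of_ne_zero_left (p n) hn
    have hfac : (q n : ℝ) * ξ - p n = (((q n / Int.gcd (q n) (p n) : ℤ) : ℝ) * ξ
        - ((p n / Int.gcd (q n) (p n) : ℤ) : ℝ)) * (Int.gcd (q n) (p n) : ℕ) := by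
      conv_lhs => rw [hqe n, hpe n]
      ring
    rw [← sub_div]
    congr 1
    rw [hfac] at hn' ⊢
    rw [abs_mul, Real.log_mul (abs_ne_zero.mpr (left_ne_zero_of_mul hn')) (by positivity),
      abs_of_pos hgpos]
    ring

namespace IsMahlerSeq

variable {a₁ a₂ : ℤ} {f : ℕ → ℤ}

theorem zero_ne_zero (h : IsMahlerSeq a₁ a₂ f) {x : ℝ} (hx : mahlerSum f x ≠ 0) : f 0 ≠ 0 := by
  intro h0
  have hf : ∀ n, f n = 0 := by
    intro n
    induction n using Nat.strong_induction_on with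
    | _ n ih =>
      rcases Nat.eq_zero_or_pos n with rfl | hn
      · exact h0
      · obtain ⟨e0, e1, e2⟩ := h (n / 3)
        have hz := ih (n / 3) (by omega)
        rw [hz] at e0 e1 e2
        have hr : n % 3 < 3 := Nat.mod_lt _ (by norm_num)
        have hdm := Nat.div_add_mod n 3
        generalize n % 3 = r at hr hdm
        interval_cases r
        · rw [← hdm, add_zero, e0]
        · rw [← hdm, e1, mul_zero]
        · rw [← hdm, e2, mul_zero]
  apply hx
  simp [mahlerSum, hf]

theorem mahlerSum_eq_mahlerProd_mul (h : IsMahlerSeq a₁ a₂ f) {b : ℤ} (hb : 2 ≤ |b|) (n : ℕ) :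
    mahlerSum f (b : ℝ)⁻¹ = (mahlerProd a₁ a₂ b n : ℝ) * mahlerSum f (((b : ℝ) ^ 3 ^ n)⁻¹) := by
  induction n with
  | zero => simp [mahlerProd]
  | succ n ih =>
    have hb0 : (b : ℝ) ≠ 0 := by
      have : b ≠ 0 := by rintro rfl; norm_num at hb
      exact_mod_cast this
    have hx : |(((b : ℝ) ^ 3 ^ n)⁻¹)| < 1 := by
      rw [← inv_pow, abs_pow]
      exact pow_lt_one₀ (abs_nonneg _) (abs_inv_intCast_lt_one hb) (by positivity)
    have hf := h.mahlerSum_functional hx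
    rw [ih, mahlerProd, mahlerProd, Finset.prod_range_succ]
    have e : (((b : ℝ) ^ 3 ^ n)⁻¹) ^ 3 = ((b : ℝ) ^ 3 ^ (n + 1))⁻¹ := by
      rw [inv_pow, ← pow_mul, ← pow_succ]
    rw [e] at hf
    push_cast
    rw [mul_assoc]
    congr 1
    have hβ : (b : ℝ) ^ 3 ^ n ≠ 0 := pow_ne_zero _ hb0
    generalize mahlerSum f (((b : ℝ) ^ 3 ^ n)⁻¹) = u at *
    generalize mahlerSum f (((b : ℝ) ^ 3 ^ (n + 1))⁻¹) = v at *
    field_simp at hf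
    linear_combination hf

theorem tendsto_inv_pow {b : ℤ} (hb : 2 ≤ |b|) :
    Tendsto (fun n : ℕ => ((b : ℝ) ^ 3 ^ n)⁻¹) atTop (𝓝 0) := by
  have h1 : Tendsto (fun n : ℕ => 3 ^ n) atTop atTop :=
    tendsto_pow_atTop_atTop_of_one_lt (by norm_num)
  refine ((tendsto_pow_atTop_nhds_zero_of_abs_lt_one (abs_inv_intCast_lt_one hb)).comp h1).congr ?_
  intro n
  rw [Function.comp_apply, inv_pow]

theorem approxFamily (h : IsMahlerSeq a₁ a₂ f) {b : ℤ} (hb : 2 ≤ |b|)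
    (h0 : mahlerSum f (b : ℝ)⁻¹ ≠ 0) {p q : ℕ → ℤ} (d e : ℕ) {κ : ℝ} (hκ : κ ≠ 0)
    (hq : Tendsto (fun n => (q n : ℝ) * (((b : ℝ) ^ 3 ^ n)⁻¹) ^ d) atTop (𝓝 1))
    (hw : Tendsto (fun n => ((b : ℝ) ^ 3 ^ n) ^ (e + 1) *
      ((q n : ℝ) * mahlerSum f (((b : ℝ) ^ 3 ^ n)⁻¹) - p n)) atTop (𝓝 κ)) {K : ℕ}
    (hK : ∀ n t, t < n → Int.gcd (q n) ((b ^ 3 ^ t) ^ 2 + a₁ * b ^ 3 ^ t + a₂) ≤ K ^ 3 ^ (n - t))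
    {M : ℕ} (hM : ∀ n, Int.gcd (q n) (p n) ≤ M) :
    ApproxFamily (mahlerSum f (b : ℝ)⁻¹) (Real.log |(b : ℝ)|) d e := by
  have hb0 : (b : ℝ) ≠ 0 := by
    have : b ≠ 0 := by rintro rfl; norm_num at hb
    exact_mod_cast this
  have hβ : ∀ n, (b : ℝ) ^ 3 ^ n ≠ 0 := fun n => pow_ne_zero _ hb0
  have hprod := h.mahlerSum_eq_mahlerProd_mul hb
  have hP : ∀ n, mahlerProd a₁ a₂ b n ≠ 0 := by
    intro n hn
    apply h0
    rw [hprod n, hn, Int.cast_zero, zero_mul]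
  have hG0 : ∀ n, mahlerSum f (((b : ℝ) ^ 3 ^ n)⁻¹) ≠ 0 := by
    intro n hn
    apply h0
    rw [hprod n, hn, mul_zero]
  have hlogβ : ∀ n, Real.log |(b : ℝ) ^ 3 ^ n| = 3 ^ n * Real.log |(b : ℝ)| := by
    intro n
    rw [abs_pow, Real.log_pow]
    push_cast
    rfl
  have hq0 : ∀ᶠ n in atTop, q n ≠ 0 := by
    filter_upwards [hq.eventually_ne one_ne_zero] with n hn hz
    simp [hz] at hn
  have hw0 : ∀ᶠ n in atTop, (q n : ℝ) * mahlerSum f (((b : ℝ) ^ 3 ^ n)⁻¹) - p n ≠ 0 := by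
    filter_upwards [hw.eventually_ne hκ] with n hn
    exact right_ne_zero_of_mul hn
  have hfac : ∀ n, (q n : ℝ) * mahlerSum f (b : ℝ)⁻¹ - ((p n * mahlerProd a₁ a₂ b n : ℤ) : ℝ)
      = mahlerProd a₁ a₂ b n * ((q n : ℝ) * mahlerSum f (((b : ℝ) ^ 3 ^ n)⁻¹) - p n) := by
    intro n
    rw [hprod n]
    push_cast
    ring
  have hPR : ∀ n, (mahlerProd a₁ a₂ b n : ℝ) ≠ 0 := fun n => by exact_mod_cast hP n
  refine ApproxFamily.of_gcd hq0 (p := fun n => p n * mahlerProd a₁ a₂ b n) ?_ ?_ ?_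
    (tendsto_log_gcd hb hP hq0 hK hM)
  · filter_upwards [hw0] with n hn
    rw [hfac]
    exact mul_ne_zero (hPR n) hn
  · have h1 := (tendsto_log_abs_div_pow_three one_ne_zero hq).add_const
      ((d : ℝ) * Real.log |(b : ℝ)|)
    rw [zero_add] at h1
    refine h1.congr' ?_
    filter_upwards [hq0] with n hn
    have hn' : (q n : ℝ) ≠ 0 := by exact_mod_cast hn
    rw [abs_mul, Real.log_mul (abs_ne_zero.mpr hn')
      (abs_ne_zero.mpr (pow_ne_zero _ (inv_ne_zero (hβ n)))), abs_pow, Real.log_pow, abs_inv,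
      Real.log_inv, hlogβ]
    field_simp
    ring
  · have hG : Tendsto (fun n => (b : ℝ) ^ 3 ^ n * mahlerSum f (((b : ℝ) ^ 3 ^ n)⁻¹)) atTop
        (𝓝 (f 0 : ℝ)) := by
      refine ((h.tendsto_mahlerTail 0).comp (tendsto_inv_pow hb)).congr' ?_
      filter_upwards [(tendsto_inv_pow hb).abs.eventually_lt_const
        (show |(0 : ℝ)| < 1 by norm_num)] with n hn
      rw [h.mahlerSum_eq_sum_add_tail 0 hn, Function.comp_apply]
      have := hβ n
      simp only [Finset.range_zero, Finset.sum_empty, zero_add, pow_one]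
      field_simp
    have hf0 : (f 0 : ℝ) ≠ 0 := by exact_mod_cast h.zero_ne_zero h0
    have h1 := ((tendsto_log_abs_div_pow_three hκ hw).sub
      (tendsto_log_abs_div_pow_three hf0 hG)).add
        (tendsto_log_abs_div_pow_three h0 (tendsto_const_nhds (x := mahlerSum f (b : ℝ)⁻¹)))
    have h2 := h1.sub_const ((e : ℝ) * Real.log |(b : ℝ)|)
    rw [sub_zero, zero_add, zero_sub] at h2
    refine h2.congr' ?_
    filter_upwards [hw0] with n hn
    have e1 : Real.log |mahlerSum f (b : ℝ)⁻¹| = Real.log |(mahlerProd a₁ a₂ b n : ℝ)|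
        + Real.log |mahlerSum f (((b : ℝ) ^ 3 ^ n)⁻¹)| := by
      rw [hprod n, abs_mul, Real.log_mul (abs_ne_zero.mpr (hPR n)) (abs_ne_zero.mpr (hG0 n))]
    rw [hfac, e1]
    simp only [abs_mul]
    rw [Real.log_mul (abs_ne_zero.mpr (pow_ne_zero _ (hβ n))) (abs_ne_zero.mpr hn),
      Real.log_mul (abs_ne_zero.mpr (hβ n)) (abs_ne_zero.mpr (hG0 n)),
      Real.log_mul (abs_ne_zero.mpr (hPR n)) (abs_ne_zero.mpr hn), abs_pow, Real.log_pow, hlogβ]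
    field_simp
    push_cast
    ring

end IsMahlerSeq

theorem irrationalityExponent_eq_three {ξ L d : ℝ} (hξ : Irrational ξ) (hL : 0 < L) (hd : 0 < d)
    (h : ApproxFamily ξ L d (2 * d)) : irrationalityExponent ξ = ((3 : ℝ) : EReal) := by
  apply le_antisymm
  · have key := irrationalityExponent_le_of_forall_gt (ξ := ξ) (τ₀ := 2) fun τ hτ => by
      refine irrationalityExponent_le_of_hasApprox hξ (by linarith)
        (exists_forall_of_eventually_interval (lo := 1.9 * d) (L := L) (by positivity) hL ?_)
      exact h.shift.eventually_hasApprox hL (by positivity) (by linarith)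
        (by nlinarith) (by nlinarith) (by nlinarith)
    norm_num at key ⊢
    exact key
  · have key := h.le_irrationalityExponent hξ hL hd (by positivity)
    rw [mul_div_cancel_right₀ _ hd.ne'] at key
    norm_num at key ⊢
    exact key

theorem irrationalityExponent_eq_twelve_fifths {ξ L : ℝ} (hξ : Irrational ξ) (hL : 0 < L)
    (h₁ : ApproxFamily ξ L 1 1) (h₄ : ApproxFamily ξ L 4 4) (h₅ : ApproxFamily ξ L 5 7) :
    irrationalityExponent ξ = ((12 / 5 : ℝ) : EReal) := by
  apply le_antisymm
  · have key := irrationalityExponent_le_of_forall_gt (ξ := ξ) (τ₀ := 7 / 5) fun τ hτ => by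
      refine irrationalityExponent_le_of_hasApprox hξ (by linarith)
        (exists_forall_of_eventually_interval (lo := 6.9) (L := L) (by norm_num) hL ?_)
      filter_upwards [h₁.shift.shift.eventually_hasApprox (τ := τ) (lo := 6.9) (hi := 8.9) hL
          (by norm_num) (by linarith) (by linarith) (by norm_num) (by linarith),
        h₄.shift.eventually_hasApprox (τ := τ) (lo := 8.9) (hi := 11.9) hL
          (by norm_num) (by linarith) (by linarith) (by norm_num) (by linarith),
        h₅.shift.eventually_hasApprox (τ := τ) (lo := 11.9) (hi := 20.7) hL
          (by norm_num) (by linarith) (by linarith) (by norm_num) (by linarith)]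
        with n hn₁ hn₄ hn₅ Y hY₁ hY₂
      rcases le_total Y (8.9 * L * 3 ^ n) with h | h
      · exact hn₁ Y hY₁ h
      rcases le_total Y (11.9 * L * 3 ^ n) with h' | h'
      · exact hn₄ Y h h'
      · exact hn₅ Y h' (by linarith)
    norm_num at key ⊢
    exact key
  · have key := h₅.le_irrationalityExponent hξ hL (by norm_num) (by norm_num)
    norm_num at key ⊢
    exact key

theorem gcd_mul_dvd_of_dvd {x y z : ℤ} {A B : ℕ} (hy : Int.gcd x y ∣ A) (hz : Int.gcd x z ∣ B) :
    Int.gcd x (y * z) ∣ A * B :=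
  (Int.gcd_mul_right_dvd_mul_gcd x y z).trans (mul_dvd_mul hy hz)

theorem gcd_dvd_natAbs_of_combination {x y u v R : ℤ} (h : u * x + v * y = R) :
    Int.gcd x y ∣ R.natAbs := by
  rw [← Int.natCast_dvd, ← h]
  exact dvd_add ((Int.gcd_dvd_left x y).mul_left u) ((Int.gcd_dvd_right x y).mul_left v)

theorem gcd_apply_sub_dvd {Q : ℤ → ℤ} (hQ : ∀ x y, x - y ∣ Q x - Q y) (x r : ℤ) :
    Int.gcd (Q x) (x - r) ∣ (Q r).natAbs := by
  rw [← Int.natCast_dvd]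
  have := dvd_sub (Int.gcd_dvd_left (Q x) (x - r)) ((Int.gcd_dvd_right (Q x) (x - r)).trans (hQ x r))
  rwa [sub_sub_cancel] at this

theorem gcd_apply_pow_sub_dvd {Q : ℤ → ℤ} (hQ : ∀ x y, x - y ∣ Q x - Q y) (b r : ℤ) {n t : ℕ}
    (ht : t < n) :
    Int.gcd (Q (b ^ 3 ^ n)) (b ^ 3 ^ t - r) ∣ (Q (r ^ 3 ^ (n - t))).natAbs := by
  refine dvd_trans (Int.gcd_dvd_gcd_of_dvd_right _ ?_) (gcd_apply_sub_dvd hQ _ _)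
  have : b ^ 3 ^ n = (b ^ 3 ^ t) ^ 3 ^ (n - t) := by
    rw [← pow_mul, ← pow_add, Nat.add_sub_cancel' ht.le]
  rw [this]
  exact sub_dvd_pow_sub_pow _ _ _

theorem IsMahlerSeq.approxFamily_of_expansion {a₁ a₂ : ℤ} {f : ℕ → ℤ} (h : IsMahlerSeq a₁ a₂ f)
    {b : ℤ} (hb : 2 ≤ |b|) (h0 : mahlerSum f (b : ℝ)⁻¹ ≠ 0) {P Q : ℤ → ℤ} {p q U V : ℝ → ℝ}
    (hp : ∀ z : ℤ, (P z : ℝ) = p z) (hq : ∀ z : ℤ, (Q z : ℝ) = q z) (d e : ℕ)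
    (hU : Continuous U) (hV : Continuous V) (hV0 : V 0 = 1) (hκ : U 0 + f (d + e) ≠ 0)
    (hqV : ∀ x, x ≠ 0 → q x⁻¹ * x ^ d = V x)
    (hqU : ∀ x, x ≠ 0 → x⁻¹ ^ (e + 1) *
      (q x⁻¹ * ∑ n ∈ Finset.range (d + e), (f n : ℝ) * x ^ (n + 1) - p x⁻¹) = U x) {K : ℕ}
    (hK : ∀ n t, t < n →
      Int.gcd (Q (b ^ 3 ^ n)) ((b ^ 3 ^ t) ^ 2 + a₁ * b ^ 3 ^ t + a₂) ≤ K ^ 3 ^ (n - t))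
    {M : ℕ} (hM0 : M ≠ 0) (hM : ∀ z, Int.gcd (Q z) (P z) ∣ M) :
    ApproxFamily (mahlerSum f (b : ℝ)⁻¹) (Real.log |(b : ℝ)|) d e := by
  have hb0 : (b : ℝ) ≠ 0 := by
    have : b ≠ 0 := by rintro rfl; norm_num at hb
    exact_mod_cast this
  have hx0 : ∀ n, ((b : ℝ) ^ 3 ^ n)⁻¹ ≠ 0 := fun n => inv_ne_zero (pow_ne_zero _ hb0)
  have hlim := tendsto_inv_pow hb
  refine h.approxFamily hb h0 (p := fun n => P (b ^ 3 ^ n)) (q := fun n => Q (b ^ 3 ^ n)) d e hκ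
    ?_ ?_ hK (fun n => Nat.le_of_dvd (Nat.pos_of_ne_zero hM0) (hM _))
  · have := (hV.tendsto 0).comp hlim
    rw [hV0] at this
    refine this.congr fun n => ?_
    rw [Function.comp_apply, ← hqV _ (hx0 n), hq, inv_inv]
    push_cast
    rfl
  · have h1 := ((hU.tendsto 0).comp hlim).add
      (((hV.tendsto 0).comp hlim).mul ((h.tendsto_mahlerTail (d + e)).comp hlim))
    rw [hV0, one_mul] at h1
    refine h1.congr' ?_
    filter_upwards [hlim.abs.eventually_lt_const (show |(0 : ℝ)| < 1 by norm_num)] with n hn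
    simp only [Function.comp_apply]
    rw [h.mahlerSum_eq_sum_add_tail (d + e) hn, hp, hq, ← hqV _ (hx0 n), ← hqU _ (hx0 n)]
    push_cast
    have hn0 := hx0 n
    have hinv : (b : ℝ) ^ 3 ^ n = (((b : ℝ) ^ 3 ^ n)⁻¹)⁻¹ := (inv_inv _).symm
    generalize ((b : ℝ) ^ 3 ^ n)⁻¹ = x at *
    rw [hinv]
    generalize q x⁻¹ = y
    generalize p x⁻¹ = z
    generalize mahlerTail f (d + e) x = R
    generalize ∑ n ∈ Finset.range (d + e), (f n : ℝ) * x ^ (n + 1) = S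
    have hx : x⁻¹ ^ (e + 1) * x ^ (d + e + 1) = x ^ d := by
      rw [show d + e + 1 = (e + 1) + d by ring, pow_add x, ← mul_assoc, ← mul_pow,
        inv_mul_cancel₀ hn0, one_pow, one_mul]
    linear_combination (-(y * R)) * hx

theorem IsMahlerSeq.mahlerSum_rational {f : ℕ → ℤ} {s : ℤ} (h : IsMahlerSeq s (s ^ 2) f)
    (hs : s ^ 3 = s) {b : ℤ} (hb : 2 ≤ |b|) : ¬ Irrational (mahlerSum f (b : ℝ)⁻¹) := by
  have hf : ∀ n, f n = f 0 * s ^ n := by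
    intro n
    induction n using Nat.strong_induction_on with
    | _ n ih =>
      rcases Nat.eq_zero_or_pos n with rfl | hn
      · simp
      · obtain ⟨e0, e1, e2⟩ := h (n / 3)
        have hz := ih (n / 3) (by omega)
        have hp : s ^ (3 * (n / 3)) = s ^ (n / 3) := by rw [pow_mul, hs]
        have hr : n % 3 < 3 := Nat.mod_lt _ (by norm_num)
        have hdm := Nat.div_add_mod n 3
        generalize n % 3 = r at hr hdm
        rw [← hdm, pow_add, hp]
        interval_cases r
        · rw [add_zero, e0, hz]; ring
        · rw [e1, hz]; ring
        · rw [e2, hz]; ring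
  have hs1 : |(s : ℝ)| ≤ 1 := by
    have : s * (s - 1) * (s + 1) = 0 := by linear_combination hs
    rcases mul_eq_zero.mp this with h | h
    · rcases mul_eq_zero.mp h with h | h
      · simp [h]
      · obtain rfl : s = 1 := by linarith
        simp
    · obtain rfl : s = -1 := by linarith
      simp
  have hlt : |(s : ℝ) * (b : ℝ)⁻¹| < 1 := by
    rw [abs_mul]
    exact (mul_le_of_le_one_left (abs_nonneg _) hs1).trans_lt (abs_inv_intCast_lt_one hb)
  have hval : mahlerSum f (b : ℝ)⁻¹ = (f 0 : ℝ) * (b : ℝ)⁻¹ * (1 - (s : ℝ) * (b : ℝ)⁻¹)⁻¹ := by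
    rw [← tsum_geometric_of_abs_lt_one hlt, ← tsum_mul_left, mahlerSum]
    refine tsum_congr fun n => ?_
    rw [hf n]
    push_cast
    ring
  rw [hval]
  intro hirr
  exact hirr ⟨(f 0 : ℚ) * (b : ℚ)⁻¹ * (1 - (s : ℚ) * (b : ℚ)⁻¹)⁻¹, by push_cast; rfl⟩

theorem log_abs_intCast_pos {b : ℤ} (hb : 2 ≤ |b|) : 0 < Real.log |(b : ℝ)| := by
  have : (2 : ℝ) ≤ |(b : ℝ)| := by exact_mod_cast hb
  exact Real.log_pos (by linarith)

namespace IsMahlerSeq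

variable {f : ℕ → ℤ} {b : ℤ}

theorem approxFamily_geometric {s : ℤ} (h : IsMahlerSeq s (s ^ 2) f) (hb : 2 ≤ |b|)
    (h0 : mahlerSum f (b : ℝ)⁻¹ ≠ 0) (hs : 2 ≤ s.natAbs) :
    ApproxFamily (mahlerSum f (b : ℝ)⁻¹) (Real.log |(b : ℝ)|) 1 2 := by
  have hf0 := h.zero_ne_zero h0
  have f1 : f 1 = s * f 0 := (h 0).2.1
  have f2 : f 2 = s ^ 2 * f 0 := (h 0).2.2
  have f3 : f 3 = s * f 0 := (h 1).1.trans f1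
  have hgt : ∀ N, 2 ≤ N → s.natAbs < s.natAbs ^ N := fun N hN => by
    calc s.natAbs = s.natAbs ^ 1 := (pow_one _).symm
      _ < s.natAbs ^ N := Nat.pow_lt_pow_right (by omega) (by omega)
  have hne : ∀ N, 2 ≤ N → s ^ N - s ≠ 0 := fun N hN h => by
    have := congrArg Int.natAbs (sub_eq_zero.mp h)
    rw [Int.natAbs_pow] at this
    exact (hgt N hN).ne' this
  have key := h.approxFamily_of_expansion hb h0 (P := fun _ => f 0) (Q := fun z => z - s)
    (p := fun _ => (f 0 : ℝ)) (q := fun z => z - s)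
    (U := fun _ => -(s : ℝ) ^ 3 * f 0) (V := fun x => 1 - s * x) (fun z => rfl)
    (fun z => by push_cast; rfl) 1 2 (by fun_prop) (by fun_prop) (by simp) ?_ ?_ ?_
    (K := 2 * s.natAbs) ?_ (M := (f 0).natAbs) (by simpa using hf0)
    (fun z => Int.natCast_dvd.mp (Int.gcd_dvd_right _ _))
  · simpa using key
  · simp only [Nat.reduceAdd, f3]
    have := mul_ne_zero (hne 3 (by norm_num)) hf0
    intro h
    apply this
    have h' : ((-s ^ 3 * f 0 + s * f 0 : ℤ) : ℝ) = 0 := by push_cast at h ⊢; exact h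
    have h'' : -s ^ 3 * f 0 + s * f 0 = 0 := by exact_mod_cast h'
    linear_combination -h''
  · intro x hx
    field_simp
  · intro x hx
    simp only [Nat.reduceAdd, Finset.sum_range_succ, Finset.sum_range_zero, f1, f2]
    push_cast
    field_simp
    ring
  · intro n t ht
    obtain ⟨m, rfl⟩ := Nat.exists_eq_add_of_lt ht
    rw [show t + m + 1 - t = m + 1 by omega]
    have hN : 2 ≤ 3 ^ (m + 1) := by
      rw [pow_succ]
      have := Nat.one_le_pow m 3 (by norm_num)
      omega
    have hdvd : Int.gcd (b ^ 3 ^ (t + m + 1) - s) ((b ^ 3 ^ t) ^ 2 + s * b ^ 3 ^ t + s ^ 2)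
        ∣ (s ^ 3 ^ (m + 1) - s).natAbs := by
      rw [← Int.natCast_dvd]
      have h1 := Int.gcd_dvd_left (b ^ 3 ^ (t + m + 1) - s)
        ((b ^ 3 ^ t) ^ 2 + s * b ^ 3 ^ t + s ^ 2)
      have h2 := Int.gcd_dvd_right (b ^ 3 ^ (t + m + 1) - s)
        ((b ^ 3 ^ t) ^ 2 + s * b ^ 3 ^ t + s ^ 2)
      have h3 : (b ^ 3 ^ t) ^ 2 + s * b ^ 3 ^ t + s ^ 2 ∣ (b ^ 3 ^ t) ^ 3 - s ^ 3 :=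
        ⟨b ^ 3 ^ t - s, by ring⟩
      have h4 := (h2.trans h3).trans (sub_dvd_pow_sub_pow _ _ (3 ^ m))
      have e1 : ((b ^ 3 ^ t) ^ 3) ^ 3 ^ m = b ^ 3 ^ (t + m + 1) := by
        rw [← pow_mul, ← pow_mul]; ring_nf
      have e2 : (s ^ 3) ^ 3 ^ m = s ^ 3 ^ (m + 1) := by rw [← pow_mul]; ring_nf
      rw [e1, e2] at h4
      have := dvd_sub h1 h4
      rwa [show b ^ 3 ^ (t + m + 1) - s - (b ^ 3 ^ (t + m + 1) - s ^ 3 ^ (m + 1))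
        = s ^ 3 ^ (m + 1) - s by ring] at this
    refine (Nat.le_of_dvd (Int.natAbs_pos.mpr (hne _ hN)) hdvd).trans ?_
    refine (Int.natAbs_sub_le _ _).trans ?_
    rw [Int.natAbs_pow, mul_pow]
    have h2 : 2 ≤ 2 ^ 3 ^ (m + 1) := Nat.le_self_pow (by positivity) 2
    nlinarith [hgt _ hN]

theorem approxFamily_split {s : ℤ} (h : IsMahlerSeq (s ^ 3) (-(s ^ 2 * (s ^ 2 + 1))) f)
    (hb : 2 ≤ |b|) (h0 : mahlerSum f (b : ℝ)⁻¹ ≠ 0) (hs : s ≠ 0) :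
    ApproxFamily (mahlerSum f (b : ℝ)⁻¹) (Real.log |(b : ℝ)|) 2 4 := by
  have hf0 := h.zero_ne_zero h0
  have f1 : f 1 = s ^ 3 * f 0 := (h 0).2.1
  have f2 : f 2 = -(s ^ 2 * (s ^ 2 + 1)) * f 0 := (h 0).2.2
  have f3 : f 3 = s ^ 3 * f 0 := (h 1).1.trans f1
  have f4 : f 4 = s ^ 3 * (s ^ 3 * f 0) := by rw [← f1]; exact (h 1).2.1
  have f5 : f 5 = -(s ^ 2 * (s ^ 2 + 1)) * (s ^ 3 * f 0) := by rw [← f1]; exact (h 1).2.2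
  have f6 : f 6 = -(s ^ 2 * (s ^ 2 + 1)) * f 0 := (h 2).1.trans f2
  have hs2 : 0 < s ^ 2 := by positivity
  set Q : ℤ → ℤ := fun z => z ^ 2 + s * z + s ^ 2 with hQdef
  have hQ : ∀ x y, x - y ∣ Q x - Q y := fun x y => ⟨x + y + s, by rw [hQdef]; ring⟩
  have hQ0 : ∀ y, Q y ≠ 0 := fun y => by
    have : 0 < Q y := by simp only [hQdef]; nlinarith [sq_nonneg (2 * y + s)]
    exact this.ne'
  set r : ℤ := -(s ^ 3 + s) with hr
  set R : ℕ := s.natAbs + r.natAbs with hR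
  have hR1 : 1 ≤ R := by have := Int.natAbs_pos.mpr hs; omega
  have hbound : ∀ y N, y.natAbs ≤ R → N ≠ 0 → (Q (y ^ N)).natAbs ≤ (3 * R ^ 2) ^ N := by
    intro y N hy hN
    have h1 : y.natAbs ^ N ≤ R ^ N := Nat.pow_le_pow_left hy N
    have h2 : s.natAbs ≤ R ^ N := (Nat.le_add_right _ _).trans (Nat.le_self_pow hN R)
    have h3 : 3 ≤ 3 ^ N := Nat.le_self_pow hN 3
    calc (Q (y ^ N)).natAbs
        ≤ (y.natAbs ^ N) ^ 2 + s.natAbs * y.natAbs ^ N + s.natAbs ^ 2 := by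
          refine (Int.natAbs_add_le _ _).trans (Nat.add_le_add
            ((Int.natAbs_add_le _ _).trans (le_of_eq ?_)) (Int.natAbs_pow _ _).le)
          rw [Int.natAbs_mul, Int.natAbs_pow, Int.natAbs_pow]
      _ ≤ (R ^ N) ^ 2 + R ^ N * R ^ N + (R ^ N) ^ 2 := by gcongr
      _ = 3 * (R ^ N) ^ 2 := by ring
      _ ≤ 3 ^ N * (R ^ N) ^ 2 := by gcongr
      _ = (3 * R ^ 2) ^ N := by rw [mul_pow, ← pow_mul, ← pow_mul, mul_comm 2]
  have key := h.approxFamily_of_expansion hb h0 (P := fun z => f 0 * (z - r)) (Q := Q)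
    (p := fun z => f 0 * (z + s ^ 3 + s)) (q := fun z => z ^ 2 + s * z + s ^ 2)
    (U := fun x => f 0 * ((-(s : ℝ) ^ 6 * (s ^ 2 + 1) + s ^ 8)
      - s ^ 7 * (s ^ 2 + 1) * x))
    (V := fun x => 1 + s * x + s ^ 2 * x ^ 2) (fun z => by rw [hr]; push_cast; ring)
    (fun z => by rw [hQdef]; push_cast; rfl) 2 4 (by fun_prop) (by fun_prop) (by simp) ?_ ?_ ?_
    (K := (3 * R ^ 2) * (3 * R ^ 2)) ?_ (M := (f 0).natAbs * (Q r).natAbs)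
    (mul_ne_zero (by simpa using hf0) (by simpa using hQ0 r))
    (fun z => gcd_mul_dvd_of_dvd (Int.natCast_dvd.mp (Int.gcd_dvd_right _ _))
      (gcd_apply_sub_dvd hQ z r))
  · simpa using key
  · simp only [Nat.reduceAdd, f6]
    intro h
    have h' : ((f 0 * (s ^ 2 * (s ^ 4 + s ^ 2 + 1)) : ℤ) : ℝ) = 0 := by
      push_cast at h ⊢
      linear_combination -h
    have h'' : f 0 * (s ^ 2 * (s ^ 4 + s ^ 2 + 1)) = 0 := by exact_mod_cast h'
    have : s ^ 2 * (s ^ 4 + s ^ 2 + 1) ≠ 0 := by positivity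
    exact mul_ne_zero hf0 this h''
  · intro x hx
    field_simp
  · intro x hx
    simp only [Nat.reduceAdd, Finset.sum_range_succ, Finset.sum_range_zero, f1, f2, f3, f4, f5]
    push_cast
    field_simp
    ring
  · intro n t ht
    have hfac : (b ^ 3 ^ t) ^ 2 + s ^ 3 * b ^ 3 ^ t + -(s ^ 2 * (s ^ 2 + 1))
        = (b ^ 3 ^ t - s) * (b ^ 3 ^ t - r) := by rw [hr]; ring
    rw [hfac, mul_pow]
    refine (Nat.le_of_dvd (Nat.mul_pos (Int.natAbs_pos.mpr (hQ0 _)) (Int.natAbs_pos.mpr (hQ0 _)))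
      (gcd_mul_dvd_of_dvd (gcd_apply_pow_sub_dvd hQ b s ht)
        (gcd_apply_pow_sub_dvd hQ b r ht))).trans ?_
    exact Nat.mul_le_mul (hbound s _ (Nat.le_add_right _ _) (by positivity))
      (hbound r _ (Nat.le_add_left _ _) (by positivity))

theorem gcd_apply_pow_square_le {Q : ℤ → ℤ} (hQ : ∀ x y, x - y ∣ Q x - Q y) (b : ℤ) {ε : ℤ}
    (hε : ε = 1 ∨ ε = -1) (hQε : Q (-ε) ≠ 0) (n t : ℕ) (ht : t < n) :
    Int.gcd (Q (b ^ 3 ^ n)) ((b ^ 3 ^ t) ^ 2 + 2 * ε * b ^ 3 ^ t + 1)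
      ≤ ((Q (-ε)).natAbs * (Q (-ε)).natAbs) ^ 3 ^ (n - t) := by
  have hfac : (b ^ 3 ^ t) ^ 2 + 2 * ε * b ^ 3 ^ t + 1 = (b ^ 3 ^ t - -ε) * (b ^ 3 ^ t - -ε) := by
    rcases hε with rfl | rfl <;> ring
  have hpow : (-ε) ^ 3 ^ (n - t) = -ε := by
    have hodd : Odd (3 ^ (n - t)) := Odd.pow (by decide)
    rcases hε with rfl | rfl
    · exact hodd.neg_one_pow
    · simp
  have h1 := gcd_apply_pow_sub_dvd hQ b (-ε) ht
  rw [hpow] at h1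
  have hpos := Int.natAbs_pos.mpr hQε
  rw [hfac]
  exact (Nat.le_of_dvd (Nat.mul_pos hpos hpos) (gcd_mul_dvd_of_dvd h1 h1)).trans
    (Nat.le_self_pow (by positivity) _)

theorem approxFamily_square_one {ε : ℤ} (hε : ε = 1 ∨ ε = -1) (h : IsMahlerSeq (2 * ε) 1 f)
    (hb : 2 ≤ |b|) (h0 : mahlerSum f (b : ℝ)⁻¹ ≠ 0) :
    ApproxFamily (mahlerSum f (b : ℝ)⁻¹) (Real.log |(b : ℝ)|) 1 1 := by
  have hf0 := h.zero_ne_zero h0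
  have hεR : (ε : ℝ) ^ 2 = 1 := by rcases hε with rfl | rfl <;> norm_num
  have f1 : f 1 = 2 * ε * f 0 := (h 0).2.1
  have f2 : f 2 = f 0 := (h 0).2.2.trans (one_mul _)
  have key := h.approxFamily_of_expansion hb h0 (P := fun _ => f 0) (Q := fun z => z - 2 * ε)
    (p := fun _ => (f 0 : ℝ)) (q := fun z => z - 2 * ε)
    (U := fun _ => -4 * f 0) (V := fun x => 1 - 2 * ε * x) (fun z => rfl)
    (fun z => by push_cast; rfl) 1 1 (by fun_prop) (by fun_prop) (by simp) ?_ ?_ ?_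
    (gcd_apply_pow_square_le (Q := fun z => z - 2 * ε) (fun x y => ⟨1, by ring⟩) b hε
      (by rcases hε with rfl | rfl <;> norm_num))
    (M := (f 0).natAbs) (by simpa using hf0)
    (fun z => Int.natCast_dvd.mp (Int.gcd_dvd_right _ _))
  · simpa using key
  · simp only [Nat.reduceAdd, f2]
    have : (f 0 : ℝ) ≠ 0 := by exact_mod_cast hf0
    intro h
    exact this (by linarith)
  · intro x hx
    field_simp
  · intro x hx
    simp only [Nat.reduceAdd, Finset.sum_range_succ, Finset.sum_range_zero, f1]
    push_cast
    field_simp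
    linear_combination (-4 * (f 0 : ℝ) * x ^ 3) * hεR

theorem approxFamily_square_four {ε : ℤ} (hε : ε = 1 ∨ ε = -1) (h : IsMahlerSeq (2 * ε) 1 f)
    (hb : 2 ≤ |b|) (h0 : mahlerSum f (b : ℝ)⁻¹ ≠ 0) :
    ApproxFamily (mahlerSum f (b : ℝ)⁻¹) (Real.log |(b : ℝ)|) 4 4 := by
  have hf0 := h.zero_ne_zero h0
  have hε2 : ε ^ 2 = 1 := by rcases hε with rfl | rfl <;> norm_num
  have f1 : f 1 = 2 * ε * f 0 := (h 0).2.1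
  have f2 : f 2 = f 0 := (h 0).2.2.trans (one_mul _)
  have f3 : f 3 = 2 * ε * f 0 := (h 1).1.trans f1
  have f4 : f 4 = 4 * f 0 := (h 1).2.1.trans (by rw [f1]; linear_combination 4 * f 0 * hε2)
  have f5 : f 5 = 2 * ε * f 0 := ((h 1).2.2.trans (one_mul _)).trans f1
  have f6 : f 6 = f 0 := (h 2).1.trans f2
  have f7 : f 7 = 2 * ε * f 0 := (h 2).2.1.trans (by rw [f2])
  have f8 : f 8 = f 0 := ((h 2).2.2.trans (one_mul _)).trans f2
  set Q : ℤ → ℤ := fun z => z ^ 4 - 2 * ε * z ^ 3 + z ^ 2 - 2 * ε * z + 3 with hQ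
  have key := h.approxFamily_of_expansion hb h0
    (P := fun z => f 0 * (z * (z ^ 2 - 2))) (Q := Q)
    (p := fun z => f 0 * (z ^ 3 - 2 * z))
    (q := fun z => z ^ 4 - 2 * ε * z ^ 3 + z ^ 2 - 2 * ε * z + 3)
    (U := fun x => f 0 * (5 + 6 * ε * x - x ^ 2 + 6 * ε * x ^ 3))
    (V := fun x => 1 - 2 * ε * x + x ^ 2 - 2 * ε * x ^ 3 + 3 * x ^ 4)
    (fun z => by push_cast; ring)
    (fun z => by rw [hQ]; push_cast; rfl) 4 4 (by fun_prop) (by fun_prop) (by simp) ?_ ?_ ?_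
    (gcd_apply_pow_square_le (fun x y => ⟨(x ^ 2 + y ^ 2) * (x + y)
        - 2 * ε * (x ^ 2 + x * y + y ^ 2) + (x + y) - 2 * ε, by rw [hQ]; ring⟩) b hε
      (by rcases hε with rfl | rfl <;> norm_num [hQ]))
    (M := (f 0).natAbs * (3 * 9)) (by simpa using hf0)
    (fun z => gcd_mul_dvd_of_dvd (Int.natCast_dvd.mp (Int.gcd_dvd_right _ _))
      (gcd_mul_dvd_of_dvd
        (gcd_dvd_natAbs_of_combination (u := 1) (R := 3)
          (v := -(z ^ 3 - 2 * ε * z ^ 2 + z - 2 * ε)) (by rw [hQ]; ring))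
        (gcd_dvd_natAbs_of_combination (u := 9 + 6 * ε * z) (R := 9)
          (v := 36 - (9 + 6 * ε * z) * (z ^ 2 - 2 * ε * z + 3))
          (by rw [hQ]; linear_combination (-36 * z ^ 2) * hε2))))
  · simpa using key
  · simp only [Nat.reduceAdd, f8]
    have : (f 0 : ℝ) ≠ 0 := by exact_mod_cast hf0
    intro h
    exact this (by linarith)
  · intro x hx
    field_simp
  · intro x hx
    simp only [Nat.reduceAdd, Finset.sum_range_succ, Finset.sum_range_zero, f1, f2, f3, f4, f5,
      f6, f7]
    rcases hε with rfl | rfl <;> push_cast <;> field_simp <;> ring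

theorem approxFamily_square_five {ε : ℤ} (hε : ε = 1 ∨ ε = -1) (h : IsMahlerSeq (2 * ε) 1 f)
    (hb : 2 ≤ |b|) (h0 : mahlerSum f (b : ℝ)⁻¹ ≠ 0) :
    ApproxFamily (mahlerSum f (b : ℝ)⁻¹) (Real.log |(b : ℝ)|) 5 7 := by
  have hf0 := h.zero_ne_zero h0
  have hε2 : ε ^ 2 = 1 := by rcases hε with rfl | rfl <;> norm_num
  have f1 : f 1 = 2 * ε * f 0 := (h 0).2.1
  have f2 : f 2 = f 0 := (h 0).2.2.trans (one_mul _)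
  have f3 : f 3 = 2 * ε * f 0 := (h 1).1.trans f1
  have f4 : f 4 = 4 * f 0 := (h 1).2.1.trans (by rw [f1]; linear_combination 4 * f 0 * hε2)
  have f5 : f 5 = 2 * ε * f 0 := ((h 1).2.2.trans (one_mul _)).trans f1
  have f6 : f 6 = f 0 := (h 2).1.trans f2
  have f7 : f 7 = 2 * ε * f 0 := (h 2).2.1.trans (by rw [f2])
  have f8 : f 8 = f 0 := ((h 2).2.2.trans (one_mul _)).trans f2
  have f9 : f 9 = 2 * ε * f 0 := (h 3).1.trans f3
  have f10 : f 10 = 4 * f 0 := (h 3).2.1.trans (by rw [f3]; linear_combination 4 * f 0 * hε2)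
  have f11 : f 11 = 2 * ε * f 0 := ((h 3).2.2.trans (one_mul _)).trans f3
  have f12 : f 12 = 4 * f 0 := (h 4).1.trans f4
  set Q : ℤ → ℤ := fun z => z ^ 5 - ε * z ^ 4 + z ^ 3 - ε * z ^ 2 + z - ε with hQdef
  have hQ : ∀ x y, x - y ∣ Q x - Q y := fun x y => ⟨x ^ 4 + x ^ 3 * y + x ^ 2 * y ^ 2 + x * y ^ 3
    + y ^ 4 - ε * ((x ^ 2 + y ^ 2) * (x + y)) + (x ^ 2 + x * y + y ^ 2) - ε * (x + y) + 1, by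
      rw [hQdef]; ring⟩
  have hQε : Q (-ε) ≠ 0 := by rcases hε with rfl | rfl <;> norm_num [hQdef]
  have key := h.approxFamily_of_expansion hb h0
    (P := fun z => f 0 * ((z - -ε) * (z ^ 3 + 2 * ε))) (Q := Q)
    (p := fun z => f 0 * ((z + ε) * (z ^ 3 + 2 * ε)))
    (q := fun z => z ^ 5 - ε * z ^ 4 + z ^ 3 - ε * z ^ 2 + z - ε)
    (U := fun x => f 0 * (-1 - ε * x - 2 * ε * x ^ 3 - 2 * x ^ 4))
    (V := fun x => 1 - ε * x + x ^ 2 - ε * x ^ 3 + x ^ 4 - ε * x ^ 5)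
    (fun z => by push_cast; ring)
    (fun z => by rw [hQdef]; push_cast; rfl) 5 7 (by fun_prop) (by fun_prop) (by simp) ?_ ?_ ?_
    (gcd_apply_pow_square_le hQ b hε hQε)
    (M := (f 0).natAbs * ((Q (-ε)).natAbs * 3))
    (mul_ne_zero (by simpa using hf0) (mul_ne_zero (by simpa using hQε) (by norm_num)))
    (fun z => gcd_mul_dvd_of_dvd (Int.natCast_dvd.mp (Int.gcd_dvd_right _ _))
      (gcd_mul_dvd_of_dvd (gcd_apply_sub_dvd hQ z (-ε))
        (gcd_dvd_natAbs_of_combination (u := z + ε) (R := 3) (v := -(z ^ 3 - 2 * ε))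
          (by rw [hQdef]; rcases hε with rfl | rfl <;> ring))))
  · simpa using key
  · simp only [Nat.reduceAdd, f12]
    have : (f 0 : ℝ) ≠ 0 := by exact_mod_cast hf0
    push_cast
    intro h
    exact this (by linarith)
  · intro x hx
    field_simp
  · intro x hx
    simp only [Nat.reduceAdd, Finset.sum_range_succ, Finset.sum_range_zero, f1, f2, f3, f4, f5,
      f6, f7, f8, f9, f10, f11]
    rcases hε with rfl | rfl <;> push_cast <;> field_simp <;> ring

theorem irrationalityExponent_geometric {s : ℤ} (h : IsMahlerSeq s (s ^ 2) f) (hb : 2 ≤ |b|)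
    (hξ : Irrational (mahlerSum f (b : ℝ)⁻¹)) :
    irrationalityExponent (mahlerSum f (b : ℝ)⁻¹) = ((3 : ℝ) : EReal) := by
  have hs : 2 ≤ s.natAbs := by
    by_contra! hlt
    refine h.mahlerSum_rational ?_ hb hξ
    obtain rfl | rfl | rfl : s = 0 ∨ s = 1 ∨ s = -1 := by omega
    all_goals norm_num
  refine irrationalityExponent_eq_three hξ (log_abs_intCast_pos hb) one_pos ?_
  rw [mul_one]
  exact h.approxFamily_geometric hb hξ.ne_zero hs

theorem irrationalityExponent_split {s : ℤ}
    (h : IsMahlerSeq (s ^ 3) (-(s ^ 2 * (s ^ 2 + 1))) f) (hb : 2 ≤ |b|)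
    (hξ : Irrational (mahlerSum f (b : ℝ)⁻¹)) :
    irrationalityExponent (mahlerSum f (b : ℝ)⁻¹) = ((3 : ℝ) : EReal) := by
  have hs : s ≠ 0 := by
    rintro rfl
    exact mahlerSum_rational (s := 0) (by simpa using h) (by norm_num) hb hξ
  refine irrationalityExponent_eq_three hξ (log_abs_intCast_pos hb) two_pos ?_
  rw [show (2 : ℝ) * 2 = 4 by norm_num]
  exact h.approxFamily_split hb hξ.ne_zero hs

theorem irrationalityExponent_square {ε : ℤ} (hε : ε = 1 ∨ ε = -1) (h : IsMahlerSeq (2 * ε) 1 f)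
    (hb : 2 ≤ |b|) (hξ : Irrational (mahlerSum f (b : ℝ)⁻¹)) :
    irrationalityExponent (mahlerSum f (b : ℝ)⁻¹) = ((12 / 5 : ℝ) : EReal) :=
  irrationalityExponent_eq_twelve_fifths hξ (log_abs_intCast_pos hb)
    (approxFamily_square_one hε h hb hξ.ne_zero) (approxFamily_square_four hε h hb hξ.ne_zero)
    (approxFamily_square_five hε h hb hξ.ne_zero)

end IsMahlerSeq

theorem theorem3 (b : ℤ) (hb : 2 ≤ |b|) :
    -- the series defining the values below converge
    (∀ (a₁ a₂ : ℤ) (g : LaurentSeries ℤ), SolvesMahlerEq a₁ a₂ g → Summable (valueTerm g b)) ∧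
    -- (a)
    (∀ (s : ℤ) (g : LaurentSeries ℤ), SolvesMahlerEq s (s ^ 2) g →
      Irrational (valueAt g b) → irrationalityExponent (valueAt g b) = ((3 : ℝ) : EReal)) ∧
    -- (b)
    (∀ (s : ℤ) (g : LaurentSeries ℤ), SolvesMahlerEq (s ^ 3) (-(s ^ 2 * (s ^ 2 + 1))) g →
      Irrational (valueAt g b) → irrationalityExponent (valueAt g b) = ((3 : ℝ) : EReal)) ∧
    -- (c)
    (∀ (a₁ : ℤ) (g : LaurentSeries ℤ), a₁ = 2 ∨ a₁ = -2 → SolvesMahlerEq a₁ 1 g →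
      Irrational (valueAt g b) →
        irrationalityExponent (valueAt g b) = ((12 / 5 : ℝ) : EReal)) := by
  refine ⟨fun a₁ a₂ g h => h.summable_valueTerm hb, fun s g h hξ => ?_, fun s g h hξ => ?_,
    fun a₁ g ha h hξ => ?_⟩
  · rw [h.valueAt_eq] at hξ ⊢
    exact h.isMahlerSeq.irrationalityExponent_geometric hb hξ
  · rw [h.valueAt_eq] at hξ ⊢
    exact h.isMahlerSeq.irrationalityExponent_split hb hξ
  · rw [h.valueAt_eq] at hξ ⊢
    obtain ⟨ε, hε, rfl⟩ : ∃ ε : ℤ, (ε = 1 ∨ ε = -1) ∧ a₁ = 2 * ε := by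
      rcases ha with rfl | rfl
      · exact ⟨1, Or.inl rfl, rfl⟩
      · exact ⟨-1, Or.inr rfl, rfl⟩
    exact IsMahlerSeq.irrationalityExponent_square hε h.isMahlerSeq hb hξ
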